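/- Let $d\ge 1$ and $k\ge 1$ be integers and let $\ell_d$ denote Lebesgue measure on $\mathbb R^d$. For a compact convex set $W\subset\mathbb R^d$ with $\ell_d(W)=1$ and $t>0$, let $\eta_t$ be a Poisson point process on $\mathbb R^d$ with intensity measure $t\,\ell_d(\cdot\cap W)$. For $\delta>0$ the Gilbert graph has vertex set $\eta_t$ and an edge between distinct $x,y\in\eta_t$ if and only if $\|x-y\|\le\delta$. A $k$-face of the Vietoris–Rips complex $R(\delta)$ is a set of $k+1$ points of $\eta_t$ which are pairwise joined by an edge, and $N_t^{(k)}=N_t^{(k)}(W,\delta)$ is the number of $k$-faces, i.e. $$N_t^{(k)}(W,\delta)=\frac1{(k+1)!}\sum_{(x_1,\dots,x_{k+1})\in\eta^{k+1}_{t,\neq}}\mathbf 1\big(\|x_i-x_j\|\le\delta\ \ \forall\, i,j\big).$$ (i) For every $L\in\mathbb R$ there is a constant $c=c(d,k,L)>0$ such that for all compact convex $W$ with $\ell_d(W)=1$, all $t,\delta>0$ with $t\delta^d\le L$, every median $m$ of $N_t^{(k)}=N_t^{(k)}(W,\delta)$, and all $u\ge 0$ with $\frac{u^2}{u+m}\ge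 c$, $$\mathbb P\big(|N_t^{(k)}-m|\ge u\big)\ \le\ 4\,t\,\ell_d(W)\,\exp\Big(-\frac1{4(k+1)^2}\,\frac{u^{2/(k+1)}}{(u+m)^{1/(k+1)}}\Big).\qquad(*)$$ (ii) Thermodynamic regime: let $(\delta_t)_{t>0}$ be positive numbers such that $\delta_t\to0$ and $t\delta_t^d$ converges to a (finite) constant as $t\to\infty$. Then there is a constant $c>0$, depending only on $d$, $k$ and the family $(\delta_t)_{t>0}$, such that $(*)$ holds with $\delta=\delta_t$ for all $t>0$, all compact convex $W$ with $\ell_d(W)=1$, every median $m$ of $N_t^{(k)}=N_t^{(k)}(W,\delta_t)$, and all $u\ge0$ with $\frac{u^2}{u+m}\ge c$. -/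

import Mathlib

open MeasureTheory ProbabilityTheory Filter Topology
open scoped NNReal ENNReal

/-- A (simple) Poisson point process with intensity measure `μ`, given as a random locally finite
set of points: the numbers of points in Borel sets are random variables, the number of points in
`A` is Poisson distributed with mean `μ A` (and is a.s. infinite if `μ A = ∞`), and the numbers
of points in finitely many pairwise disjoint Borel sets are independent. -/
structure IsPoissonProcess {E Ω : Type*} [TopologicalSpace E] [MeasurableSpace E]
    [MeasurableSpace Ω] (P : Measure Ω) (μ : Measure E) (η : Ω → Set E) : Prop where
  locallyFinite : ∀ ω, ∀ K : Set E, IsCompact K → (η ω ∩ K).Finite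
  measurable_count : ∀ A : Set E, MeasurableSet A → Measurable fun ω => (η ω ∩ A).encard
  law_count : ∀ A : Set E, MeasurableSet A → μ A ≠ ∞ →
    P.map (fun ω => (η ω ∩ A).encard) =
      (poissonMeasure (μ A).toNNReal).map (Nat.cast : ℕ → ℕ∞)
  infinite_count : ∀ A : Set E, MeasurableSet A → μ A = ∞ → ∀ᵐ ω ∂P, (η ω ∩ A).encard = ⊤
  indep_count : ∀ (n : ℕ) (A : Fin n → Set E), (∀ i, MeasurableSet (A i)) →
    Pairwise (fun i j => Disjoint (A i) (A j)) →
    iIndepFun (fun i ω => (η ω ∩ A i).encard) P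

/-- The Gilbert graph of the point set `η` with threshold `δ`: two distinct points of `η` are
joined by an edge if and only if their distance is at most `δ`. (Points outside `η` are isolated;
they are not vertices.) -/
def gilbertGraph {E : Type*} [PseudoMetricSpace E] (η : Set E) (δ : ℝ) : SimpleGraph E where
  Adj x y := x ∈ η ∧ y ∈ η ∧ x ≠ y ∧ dist x y ≤ δ
  symm := ⟨fun x y h => ⟨h.2.1, h.1, h.2.2.1.symm, dist_comm x y ▸ h.2.2.2⟩⟩
  loopless := ⟨fun _ h => h.2.2.1 rfl⟩

/-- The `k`-faces of the Vietoris–Rips complex over the point set `η` with threshold `δ`: the sets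
of `k + 1` points of `η` which are pairwise connected by an edge of the Gilbert graph. -/
def vietorisRipsFaces {E : Type*} [PseudoMetricSpace E] (η : Set E) (δ : ℝ) (k : ℕ) :
    Set (Finset E) :=
  {F | (F : Set E) ⊆ η ∧ F.card = k + 1 ∧ (gilbertGraph η δ).IsClique (F : Set E)}

/-- The number of `k`-faces of the Vietoris–Rips complex (as a real number). -/
noncomputable def faceCount {E : Type*} [PseudoMetricSpace E] (η : Set E) (δ : ℝ) (k : ℕ) : ℝ :=
  ((vietorisRipsFaces η δ k).ncard : ℝ)

/-- `m` is a median of the real random variable `X`. -/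
def IsMedian {Ω : Type*} [MeasurableSpace Ω] (P : Measure Ω) (X : Ω → ℝ) (m : ℝ) : Prop :=
  1 / 2 ≤ P.real {ω | X ω ≤ m} ∧ 1 / 2 ≤ P.real {ω | m ≤ X ω}

/-! The core is Talagrand's convex distance method. For a random set with independent inclusions,
moving from `T` into a family `A` by deleting points costs at most a scalar product with a vector
whose squared norm, divided by 16, has exponential moment at most 1/P(A) when P(A) > 0
(`exists_convex_distance_vector`). Let the cost of a vertex be the number of (k+1)-cliques through
it: the cost of the deleted vertices bounds the loss of cliques. If at most M cliques pass through
each vertex, Cauchy–Schwarz and double counting give P(count ≤ a) · P(count ≥ b, local bound M) ≤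
exp(-(b-a)²/(16(k+1)Mb)) (`bernoulliWeight_cliquesIn_mul_le`).

For the Poisson process, space is cut into small cubes, which are occupied independently of each
other. The configuration is almost surely finite, so a sufficiently fine mesh reproduces its Gilbert
graph, and the inequality passes to the limit (`IsPoissonProcess.faceCount_mul_le`).

The local bound comes from truncating the degrees. Put y^(k+1) = u²/(u+m) and truncate at about y/8,
so that M = (y/8)^k and the exponent becomes linear in y. A larger degree forces many points into
one block of cubes of side δ. A Poisson tail and a union bound make this unlikely: summing over the
blocks produces the factor t, and the factorial beats every exponential once y is large, which is
why u²/(u+m) ≥ c is required. The pairs (m, m+u) and (m-u, m) then give both tails if t ≥ 1. If t <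
1 the median is 0, and the tail of the number of points is enough.

The window and δ enter the constant only through a bound on the mean number of points in a block.
This bound follows from tδ^d ≤ L, or from t ≤ L because the total mass is t; in (ii) the first
applies to large t and the second to the remaining t. -/

/-- The probability that the random subset of `s` which contains every `i ∈ s` independently with
probability `p i` is equal to `T`. -/
noncomputable def bernoulliWeight {α : Type*} [DecidableEq α] (p : α → ℝ) (s T : Finset α) : ℝ :=
  ∏ i ∈ s, if i ∈ T then p i else 1 - p i

/-! ### Convex distance inequality for independent random subsets -/

section Bernoulli

variable {α : Type*} [DecidableEq α]

theorem bernoulliWeight_nonneg {p : α → ℝ} (hp0 : ∀ i, 0 ≤ p i) (hp1 : ∀ i, p i ≤ 1)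
    (s T : Finset α) : 0 ≤ bernoulliWeight p s T := by
  refine Finset.prod_nonneg fun i _ => ?_
  split_ifs
  · exact hp0 i
  · linarith [hp1 i]

theorem bernoulliWeight_insert_of_subset (p : α → ℝ) {s T : Finset α} {a : α} (ha : a ∉ s)
    (hT : T ⊆ s) : bernoulliWeight p (insert a s) T = (1 - p a) * bernoulliWeight p s T := by
  have : a ∉ T := fun h => ha (hT h)
  simp [bernoulliWeight, Finset.prod_insert ha, this]

theorem bernoulliWeight_insert_insert (p : α → ℝ) {s T : Finset α} {a : α} (ha : a ∉ s) :
    bernoulliWeight p (insert a s) (insert a T) = p a * bernoulliWeight p s T := by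
  rw [bernoulliWeight, bernoulliWeight, Finset.prod_insert ha]
  congr 1
  · simp
  · refine Finset.prod_congr rfl fun i hi => ?_
    have : i ≠ a := fun h => ha (h ▸ hi)
    simp [this]

/-- The optimisation over the mixing parameter in the induction for the convex distance. -/
theorem exists_mixing_parameter {r : ℝ} (hr0 : 0 ≤ r) (hr1 : r ≤ 1) :
    ∃ l : ℝ, 0 ≤ l ∧ l ≤ 1 ∧ (l ≠ 0 → 0 < r) ∧
      Real.exp ((1 - l) ^ 2 / 16 - l * Real.log r) ≤ 2 - r := by
  rcases le_total r (3 / 4) with h | h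
  · refine ⟨0, le_rfl, zero_le_one, fun h => absurd rfl h, ?_⟩
    have h1 : Real.exp (1 / 16 : ℝ) ≤ 5 / 4 := by
      rw [← Real.le_log_iff_exp_le (by norm_num)]
      have := Real.one_sub_inv_le_log_of_pos (show (0 : ℝ) < 5 / 4 by norm_num)
      norm_num at this ⊢
      linarith
    norm_num at h1 ⊢
    linarith
  · have hr : 0 < r := by linarith
    -- A linear choice is good enough: it is 1 at r = 1 and reaches 0 exactly at the threshold 3/4,
    -- below which l = 0 works.
    refine ⟨1 - 4 * (1 - r), by linarith, by linarith, fun _ => hr, ?_⟩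
    rw [← Real.le_log_iff_exp_le (by linarith)]
    obtain ⟨x, rfl⟩ : ∃ x, r = 1 - x := ⟨1 - r, by ring⟩
    have hx0 : 0 ≤ x := by linarith
    have hx1 : x ≤ 1 / 4 := by linarith
    have h1 : -Real.log (1 - x) ≤ x + 4 / 3 * x ^ 2 := by
      have := Real.one_sub_inv_le_log_of_pos hr
      have h2 : (1 - x)⁻¹ ≤ 1 + x + 4 / 3 * x ^ 2 := by
        rw [inv_le_iff_one_le_mul₀ hr]
        nlinarith [mul_nonneg (sq_nonneg x) (show 0 ≤ 1 / 4 - x by linarith)]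
      linarith
    have h3 : x - x ^ 2 / 2 ≤ Real.log (2 - (1 - x)) := by
      have h4 := Real.le_log_one_add_of_nonneg hx0
      have h5 : x - x ^ 2 / 2 ≤ 2 * x / (x + 2) := by
        rw [le_div_iff₀ (by linarith)]
        nlinarith [pow_nonneg hx0 3]
      have h6 : 2 - (1 - x) = 1 + x := by ring
      rw [h6]
      linarith
    have h7 : (1 - 4 * x) * -Real.log (1 - x) ≤ (1 - 4 * x) * (x + 4 / 3 * x ^ 2) :=
      mul_le_mul_of_nonneg_left h1 (by linarith)
    have h8 : 1 - (1 - x) = x := by ring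
    rw [h8]
    nlinarith [pow_nonneg hx0 3, sq_nonneg x]

/-- A substitute for Hölder's inequality: absorb the normalisations `a` and `f` into the exponents
as logarithms, apply convexity of exp termwise and sum. -/
theorem sum_mul_exp_mix_le {β : Type*} {s : Finset β} {w A B : β → ℝ} (hw : ∀ i ∈ s, 0 ≤ w i)
    {l a f : ℝ} (hl0 : 0 ≤ l) (hl1 : l ≤ 1) (ha : 0 < a) (hf : 0 < f)
    (hA : (∑ i ∈ s, w i * Real.exp (A i)) * a ≤ 1) (hB : (∑ i ∈ s, w i * Real.exp (B i)) * f ≤ 1) :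
    (∑ i ∈ s, w i * Real.exp (l * A i + (1 - l) * B i)) * f ≤
      Real.exp (-(l * Real.log (a / f))) := by
  have key : ∀ i ∈ s, w i * Real.exp (l * A i + (1 - l) * B i) *
      Real.exp (l * Real.log a + (1 - l) * Real.log f) ≤
      l * (w i * Real.exp (A i) * a) + (1 - l) * (w i * Real.exp (B i) * f) := by
    intro i hi
    have h := convexOn_exp.2 (Set.mem_univ (A i + Real.log a)) (Set.mem_univ (B i + Real.log f))
      hl0 (sub_nonneg.2 hl1) (by ring)
    have hea : Real.exp (A i + Real.log a) = Real.exp (A i) * a := by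
      rw [Real.exp_add, Real.exp_log ha]
    have hef : Real.exp (B i + Real.log f) = Real.exp (B i) * f := by
      rw [Real.exp_add, Real.exp_log hf]
    simp only [smul_eq_mul, hea, hef] at h
    rw [mul_assoc, ← Real.exp_add]
    calc _ = w i * Real.exp (l * (A i + Real.log a) + (1 - l) * (B i + Real.log f)) := by
            ring_nf
      _ ≤ w i * (l * (Real.exp (A i) * a) + (1 - l) * (Real.exp (B i) * f)) :=
            mul_le_mul_of_nonneg_left h (hw i hi)
      _ = _ := by ring
  have h1 := Finset.sum_le_sum key
  rw [← Finset.sum_mul, Finset.sum_add_distrib, ← Finset.mul_sum, ← Finset.mul_sum,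
    ← Finset.sum_mul, ← Finset.sum_mul] at h1
  have h2 : (∑ i ∈ s, w i * Real.exp (l * A i + (1 - l) * B i)) *
      Real.exp (l * Real.log a + (1 - l) * Real.log f) ≤ 1 := by
    refine h1.trans ?_
    have := mul_le_mul_of_nonneg_left hA hl0
    have := mul_le_mul_of_nonneg_left hB (sub_nonneg.2 hl1)
    linarith
  have h3 : Real.exp (l * Real.log a + (1 - l) * Real.log f) =
      f * Real.exp (l * Real.log (a / f)) := by
    rw [Real.log_div ha.ne' hf.ne']
    nth_rw 2 [← Real.exp_log hf]
    rw [← Real.exp_add]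
    ring_nf
  rw [h3, ← mul_assoc] at h2
  rw [Real.exp_neg]
  rwa [← le_div_iff₀ (Real.exp_pos _), one_div] at h2

theorem sq_mix_le {l x y : ℝ} (hl0 : 0 ≤ l) (hl1 : l ≤ 1) :
    (l * x + (1 - l) * y) ^ 2 ≤ l * x ^ 2 + (1 - l) * y ^ 2 := by
  nlinarith [mul_nonneg (mul_nonneg hl0 (sub_nonneg.2 hl1)) (sq_nonneg (x - y))]

/-- **Talagrand's convex distance inequality** for random subsets, in a one-sided form:
for every nonempty family `A` of subsets of `s` there are vectors `z T` such that, for nonnegative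
costs, the cheapest deletion of points of `T` leading to a subset of an element of `A` costs at most
the scalar product with `z T`, while the square norm of `z T` has a bounded exponential moment. -/
theorem exists_convex_distance_vector {p : α → ℝ} (hp0 : ∀ i, 0 ≤ p i) (hp1 : ∀ i, p i ≤ 1)
    (s : Finset α) : ∀ A : Finset (Finset α), A ⊆ s.powerset → A.Nonempty →
      ∃ z : Finset α → α → ℝ,
        (∀ T ⊆ s, ∀ c : α → ℝ, (∀ i, 0 ≤ c i) →
          ∃ S ∈ A, ∑ i ∈ T \ S, c i ≤ ∑ i ∈ T, c i * z T i) ∧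
        (∑ T ∈ s.powerset, bernoulliWeight p s T * Real.exp ((∑ i ∈ T, z T i ^ 2) / 16)) *
          ∑ S ∈ A, bernoulliWeight p s S ≤ 1 := by
  induction s using Finset.induction with
  | empty =>
    intro A hA hne
    obtain ⟨S, hS⟩ := hne
    have hS0 : S = ∅ := by simpa using hA hS
    subst hS0
    have hA' : A = {∅} := by
      apply Finset.Subset.antisymm
      · simpa using hA
      · simpa using hS
    subst hA'
    refine ⟨fun _ _ => 0, ?_, ?_⟩
    · intro T hT c _
      have : T = ∅ := by simpa using hT
      subst this
      exact ⟨∅, by simp, by simp⟩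
    · simp [bernoulliWeight]
  | insert a s ha ih =>
    intro A hA hne
    -- `A1` and `A0` are the sections of `A` with `a` present and absent, and `F` is the projection
    -- of `A`. If `a ∉ T`, the vector of `F` serves, since only deletions cost. If `a ∈ T`, either
    -- aim at `A1` and keep `a`, or aim at `F` and pay for `a`; the vector mixes the two with
    -- weights l and 1 - l.
    set A1 := s.powerset.filter (fun S => insert a S ∈ A) with hA1
    set A0 := s.powerset.filter (fun S => S ∈ A) with hA0
    set F := s.powerset.filter (fun S => S ∈ A ∨ insert a S ∈ A) with hF
    set w := bernoulliWeight p s with hw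
    have hw0 : ∀ T, 0 ≤ w T := bernoulliWeight_nonneg hp0 hp1 s
    have hFne : F.Nonempty := by
      obtain ⟨S, hS⟩ := hne
      have hSs := Finset.mem_powerset.1 (hA hS)
      refine ⟨S.erase a, ?_⟩
      rw [hF, Finset.mem_filter, Finset.mem_powerset]
      refine ⟨fun x hx => ?_, ?_⟩
      · have := hSs (Finset.mem_of_mem_erase hx)
        rw [Finset.mem_insert] at this
        exact this.resolve_left (Finset.ne_of_mem_erase hx)
      · by_cases h : a ∈ S
        · right; rwa [Finset.insert_erase h]
        · left; rwa [Finset.erase_eq_of_notMem h]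
    obtain ⟨zF, hzF, hEF⟩ := ih F (Finset.filter_subset _ _) hFne
    set f := ∑ S ∈ F, w S with hf
    set a1 := ∑ S ∈ A1, w S with ha1
    set a0 := ∑ S ∈ A0, w S with ha0
    have ha1f : a1 ≤ f := Finset.sum_le_sum_of_subset_of_nonneg
      (fun S hS => by
        simp only [hA1, hF, Finset.mem_filter] at hS ⊢
        exact ⟨hS.1, Or.inr hS.2⟩) (fun _ _ _ => hw0 _)
    have ha0f : a0 ≤ f := Finset.sum_le_sum_of_subset_of_nonneg
      (fun S hS => by
        simp only [hA0, hF, Finset.mem_filter] at hS ⊢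
        exact ⟨hS.1, Or.inl hS.2⟩) (fun _ _ _ => hw0 _)
    have ha1n : 0 ≤ a1 := Finset.sum_nonneg fun _ _ => hw0 _
    have hfn : 0 ≤ f := Finset.sum_nonneg fun _ _ => hw0 _
    have hr0 : 0 ≤ a1 / f := div_nonneg ha1n hfn
    have hr1 : a1 / f ≤ 1 := div_le_one_of_le₀ ha1f hfn
    obtain ⟨l, hl0, hl1, hlr, hlam⟩ := exists_mixing_parameter hr0 hr1
    -- the family `A1` is used only if it has positive probability
    have hz1 : ∃ z1 : Finset α → α → ℝ, (l ≠ 0 → ∀ T ⊆ s, ∀ c : α → ℝ, (∀ i, 0 ≤ c i) →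
          ∃ S ∈ A1, ∑ i ∈ T \ S, c i ≤ ∑ i ∈ T, c i * z1 T i) ∧
        (l ≠ 0 → (∑ T ∈ s.powerset, w T * Real.exp ((∑ i ∈ T, z1 T i ^ 2) / 16)) * a1 ≤ 1) := by
      by_cases hl : l = 0
      · exact ⟨0, fun h => absurd hl h, fun h => absurd hl h⟩
      · have hA1ne : A1.Nonempty := by
          rw [Finset.nonempty_iff_ne_empty]
          intro h
          have := hlr hl
          rw [ha1, h] at this
          simp at this
        obtain ⟨z1, h1, h2⟩ := ih A1 (Finset.filter_subset _ _) hA1ne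
        exact ⟨z1, fun _ => h1, fun _ => h2⟩
    obtain ⟨z1, hz1, hE1⟩ := hz1
    set D1 : Finset α → ℝ := fun T => (∑ i ∈ T, z1 T i ^ 2) / 16 with hD1
    set DF : Finset α → ℝ := fun T => (∑ i ∈ T, zF T i ^ 2) / 16 with hDF
    set EF := ∑ T ∈ s.powerset, w T * Real.exp (DF T) with hEFdef
    set EM := Real.exp ((1 - l) ^ 2 / 16) *
      ∑ T ∈ s.powerset, w T * Real.exp (l * D1 T + (1 - l) * DF T) with hEM
    have hEFn : 0 ≤ EF := Finset.sum_nonneg fun _ _ => mul_nonneg (hw0 _) (Real.exp_pos _).le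
    have hEMn : 0 ≤ EM := mul_nonneg (Real.exp_pos _).le
      (Finset.sum_nonneg fun _ _ => mul_nonneg (hw0 _) (Real.exp_pos _).le)
    have hEMf : 0 < f → EM * f ≤ 2 - a1 / f := by
      intro hfpos
      refine le_trans ?_ hlam
      rw [sub_eq_add_neg, Real.exp_add, hEM, mul_assoc]
      refine mul_le_mul_of_nonneg_left ?_ (Real.exp_pos _).le
      by_cases hl : l = 0
      · simpa [hl] using hEF
      · refine sum_mul_exp_mix_le (fun _ _ => hw0 _) hl0 hl1 ?_ hfpos (hE1 hl) hEF
        have := hlr hl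
        rcases ha1n.lt_or_eq with h | h
        · exact h
        · rw [← h] at this; simp at this
    refine ⟨fun T i => if a ∈ T then (if i = a then 1 - l else
      l * z1 (T.erase a) i + (1 - l) * zF (T.erase a) i) else zF T i, ?_, ?_⟩
    · intro T hT c hc
      by_cases haT : a ∈ T
      · obtain ⟨U, hU, rfl⟩ : ∃ U, a ∉ U ∧ T = insert a U :=
          ⟨T.erase a, Finset.notMem_erase a T, (Finset.insert_erase haT).symm⟩
        have hUs : U ⊆ s := fun x hx => by
          have := hT (Finset.mem_insert_of_mem hx)
          rw [Finset.mem_insert] at this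
          exact this.resolve_left (fun h => hU (h ▸ hx))
        have hrhs : ∑ i ∈ insert a U, c i * (if a ∈ insert a U then (if i = a then 1 - l else
            l * z1 ((insert a U).erase a) i + (1 - l) * zF ((insert a U).erase a) i) else
              zF (insert a U) i) =
            l * (∑ i ∈ U, c i * z1 U i) + (1 - l) * (c a + ∑ i ∈ U, c i * zF U i) := by
          rw [Finset.sum_insert hU, Finset.erase_insert hU]
          simp only [Finset.mem_insert_self, if_true]
          rw [mul_add, Finset.mul_sum, Finset.mul_sum]
          have : ∀ i ∈ U, c i * (if i = a then 1 - l else l * z1 U i + (1 - l) * zF U i) =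
              l * (c i * z1 U i) + (1 - l) * (c i * zF U i) := by
            intro i hi
            have hia : i ≠ a := fun h => hU (h ▸ hi)
            rw [if_neg hia]
            ring
          rw [Finset.sum_congr rfl this, Finset.sum_add_distrib]
          ring
        simp only at hrhs ⊢
        rw [hrhs]
        obtain ⟨SF, hSF, hSFle⟩ := hzF U hUs c hc
        obtain ⟨S', hS', hS'le⟩ : ∃ S' ∈ A, ∑ i ∈ insert a U \ S', c i ≤
            c a + ∑ i ∈ U, c i * zF U i := by
          obtain ⟨S', hS', hsub⟩ : ∃ S' ∈ A, SF ⊆ S' := by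
            rw [hF, Finset.mem_filter] at hSF
            rcases hSF.2 with h | h
            · exact ⟨SF, h, subset_rfl⟩
            · exact ⟨_, h, Finset.subset_insert _ _⟩
          refine ⟨S', hS', ?_⟩
          calc ∑ i ∈ insert a U \ S', c i ≤ ∑ i ∈ insert a (U \ SF), c i := by
                refine Finset.sum_le_sum_of_subset_of_nonneg (fun x hx => ?_) (fun _ _ _ => hc _)
                simp only [Finset.mem_sdiff, Finset.mem_insert] at hx ⊢
                rcases hx.1 with h | h
                · exact Or.inl h
                · exact Or.inr ⟨h, fun h' => hx.2 (hsub h')⟩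
            _ = c a + ∑ i ∈ U \ SF, c i := Finset.sum_insert (by simp [hU])
            _ ≤ _ := by linarith
        by_cases hl : l = 0
        · exact ⟨S', hS', by rw [hl]; linarith⟩
        · obtain ⟨S1, hS1, hS1le⟩ := hz1 hl U hUs c hc
          have hS1' : ∑ i ∈ insert a U \ insert a S1, c i ≤ ∑ i ∈ U, c i * z1 U i := by
            refine le_trans (Finset.sum_le_sum_of_subset_of_nonneg (fun x hx => ?_)
              (fun _ _ _ => hc _)) hS1le
            simp only [Finset.mem_sdiff, Finset.mem_insert, not_or] at hx ⊢
            exact ⟨hx.1.resolve_left hx.2.1, hx.2.2⟩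
          -- The cheaper of the two strategies costs at most their convex combination.
          rcases le_total (∑ i ∈ U, c i * z1 U i) (c a + ∑ i ∈ U, c i * zF U i) with h | h
          · refine ⟨insert a S1, (Finset.mem_filter.1 hS1).2, ?_⟩
            nlinarith
          · exact ⟨S', hS', by nlinarith⟩
      · have hTs : T ⊆ s := fun x hx => by
          have := hT hx
          rw [Finset.mem_insert] at this
          exact this.resolve_left (fun h => haT (h ▸ hx))
        obtain ⟨S, hS, hle⟩ := hzF T hTs c hc
        simp only [if_neg haT]
        rw [hF, Finset.mem_filter] at hS
        rcases hS.2 with h | h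
        · exact ⟨S, h, hle⟩
        · refine ⟨insert a S, h, ?_⟩
          rwa [Finset.sdiff_insert_of_notMem haT]
    · have hsumA : ∑ S ∈ A, bernoulliWeight p (insert a s) S = (1 - p a) * a0 + p a * a1 := by
        have h1 : ∑ S ∈ A, bernoulliWeight p (insert a s) S =
            ∑ S ∈ (insert a s).powerset, if S ∈ A then bernoulliWeight p (insert a s) S else 0 := by
          rw [← Finset.sum_filter, Finset.filter_mem_eq_inter, Finset.inter_eq_right.2 hA]
        rw [h1, Finset.sum_powerset_insert ha, ha0, ha1, hA0, hA1, Finset.sum_filter,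
          Finset.sum_filter, Finset.mul_sum, Finset.mul_sum]
        congr 1
        · refine Finset.sum_congr rfl fun S hS => ?_
          rw [bernoulliWeight_insert_of_subset p ha (Finset.mem_powerset.1 hS), mul_ite, mul_zero]
        · refine Finset.sum_congr rfl fun S _ => ?_
          rw [bernoulliWeight_insert_insert p ha, mul_ite, mul_zero]
      rw [hsumA, Finset.sum_powerset_insert ha]
      have hpart0 : ∀ T ∈ s.powerset, bernoulliWeight p (insert a s) T *
          Real.exp ((∑ i ∈ T, (if a ∈ T then (if i = a then 1 - l else
            l * z1 (T.erase a) i + (1 - l) * zF (T.erase a) i) else zF T i) ^ 2) / 16) =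
          (1 - p a) * (w T * Real.exp (DF T)) := by
        intro T hT
        rw [Finset.mem_powerset] at hT
        have haT : a ∉ T := fun h => ha (hT h)
        simp only [bernoulliWeight_insert_of_subset p ha hT, haT, if_false, mul_assoc]
        rfl
      have hpart1 : ∀ T ∈ s.powerset, bernoulliWeight p (insert a s) (insert a T) *
          Real.exp ((∑ i ∈ insert a T, (if a ∈ insert a T then (if i = a then 1 - l else
            l * z1 ((insert a T).erase a) i + (1 - l) * zF ((insert a T).erase a) i) else
              zF (insert a T) i) ^ 2) / 16) ≤
          p a * (Real.exp ((1 - l) ^ 2 / 16) * (w T * Real.exp (l * D1 T + (1 - l) * DF T))) := by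
        intro T hT
        rw [Finset.mem_powerset] at hT
        have haT : a ∉ T := fun h => ha (hT h)
        rw [bernoulliWeight_insert_insert p ha, mul_assoc]
        refine mul_le_mul_of_nonneg_left ?_ (hp0 a)
        rw [mul_left_comm, ← Real.exp_add]
        refine mul_le_mul_of_nonneg_left (Real.exp_le_exp.2 ?_) (hw0 T)
        rw [Finset.sum_insert haT, Finset.erase_insert haT]
        simp only [Finset.mem_insert_self, if_true]
        have : ∑ i ∈ T, (if i = a then 1 - l else l * z1 T i + (1 - l) * zF T i) ^ 2 ≤
            l * ∑ i ∈ T, z1 T i ^ 2 + (1 - l) * ∑ i ∈ T, zF T i ^ 2 := by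
          rw [Finset.mul_sum, Finset.mul_sum, ← Finset.sum_add_distrib]
          refine Finset.sum_le_sum fun i hi => ?_
          have hia : i ≠ a := fun h => haT (h ▸ hi)
          rw [if_neg hia]
          exact sq_mix_le hl0 hl1
        simp only [hD1, hDF]
        linarith
      have hE := add_le_add (Finset.sum_congr rfl hpart0).le (Finset.sum_le_sum hpart1)
      rw [← Finset.mul_sum, ← Finset.mul_sum, ← Finset.mul_sum] at hE
      have hpa0 := hp0 a
      have hpa1 : 0 ≤ 1 - p a := by linarith [hp1 a]
      have hP0 : 0 ≤ (1 - p a) * a0 + p a * a1 :=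
        add_nonneg (mul_nonneg hpa1 (Finset.sum_nonneg fun _ _ => hw0 _)) (mul_nonneg hpa0 ha1n)
      refine (mul_le_mul_of_nonneg_right hE hP0).trans ?_
      have hPle : (1 - p a) * a0 + p a * a1 ≤ (1 - p a) * f + p a * a1 := by
        have := mul_le_mul_of_nonneg_left ha0f hpa1
        linarith
      change ((1 - p a) * EF + p a * EM) * _ ≤ 1
      have hEn : 0 ≤ (1 - p a) * EF + p a * EM :=
        add_nonneg (mul_nonneg hpa1 hEFn) (mul_nonneg hpa0 hEMn)
      refine (mul_le_mul_of_nonneg_left hPle hEn).trans ?_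
      rcases hfn.lt_or_eq with hfpos | hf0
      · have h2 := hEMf hfpos
        set r := a1 / f with hr
        have ha1r : a1 = r * f := by rw [hr]; field_simp
        have h3 : ((1 - p a) * EF + p a * EM) * ((1 - p a) * f + p a * a1) =
            ((1 - p a) * (EF * f) + p a * (EM * f)) * ((1 - p a) + p a * r) := by
          rw [ha1r]; ring
        rw [h3]
        have h4 : (1 - p a) * (EF * f) + p a * (EM * f) ≤ (1 - p a) * 1 + p a * (2 - r) :=
          add_le_add (mul_le_mul_of_nonneg_left hEF hpa1) (mul_le_mul_of_nonneg_left h2 hpa0)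
        refine (mul_le_mul_of_nonneg_right h4 (add_nonneg hpa1 (mul_nonneg hpa0 hr0))).trans ?_
        -- With x = p a (1 - r) the product is (1 + x)(1 - x) = 1 - x².
        nlinarith [sq_nonneg (p a * (1 - r))]
      · have : a1 = 0 := by linarith
        rw [this, ← hf0]
        simp

end Bernoulli

/-! ### Clique counts in random induced subgraphs -/

section Cliques

variable {α : Type*} [DecidableEq α]

open Classical in
/-- The cliques with `k + 1` vertices of the graph `H` inside the finite set `T`. -/
noncomputable def cliquesIn (H : SimpleGraph α) (k : ℕ) (T : Finset α) : Finset (Finset α) :=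
  (T.powersetCard (k + 1)).filter fun S => H.IsClique (S : Set α)

/-- The cliques with `k + 1` vertices of the graph `H` inside `T` which contain `x`. -/
noncomputable def cliquesThrough (H : SimpleGraph α) (k : ℕ) (T : Finset α) (x : α) :
    Finset (Finset α) :=
  (cliquesIn H k T).filter fun S => x ∈ S

open Classical in
/-- All degrees in the graph induced by `H` on `T` are less than `j`. -/
def HasDegreeLT (H : SimpleGraph α) (T : Finset α) (j : ℕ) : Prop :=
  ∀ x ∈ T, (T.filter fun y => H.Adj x y).card < j

theorem mem_cliquesIn {H : SimpleGraph α} {k : ℕ} {T S : Finset α} :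
    S ∈ cliquesIn H k T ↔ S ⊆ T ∧ S.card = k + 1 ∧ H.IsClique (S : Set α) := by
  classical
  rw [cliquesIn, Finset.mem_filter, Finset.mem_powersetCard, and_assoc]

theorem card_cliquesIn_le_choose (H : SimpleGraph α) (k : ℕ) (T : Finset α) :
    (cliquesIn H k T).card ≤ T.card.choose (k + 1) := by
  rw [← Finset.card_powersetCard]
  exact Finset.card_le_card fun S hS =>
    Finset.mem_powersetCard.2 ⟨(mem_cliquesIn.1 hS).1, (mem_cliquesIn.1 hS).2.1⟩

/-- A clique of `T` not contained in `S` has a vertex in `T \ S`. This turns a drop of the clique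
count into a deletion cost. -/
theorem card_cliquesIn_le (H : SimpleGraph α) (k : ℕ) (T S : Finset α) :
    (cliquesIn H k T).card ≤
      (cliquesIn H k S).card + ∑ x ∈ T \ S, (cliquesThrough H k T x).card := by
  refine le_trans ?_ (Nat.add_le_add_left Finset.card_biUnion_le _)
  refine le_trans (Finset.card_le_card fun U hU => ?_) (Finset.card_union_le _ _)
  rw [Finset.mem_union, Finset.mem_biUnion]
  by_cases h : U ⊆ S
  · left
    rw [mem_cliquesIn] at hU ⊢
    exact ⟨h, hU.2⟩
  · right
    obtain ⟨x, hxU, hxS⟩ := Finset.not_subset.1 h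
    refine ⟨x, Finset.mem_sdiff.2 ⟨(mem_cliquesIn.1 hU).1 hxU, hxS⟩, ?_⟩
    exact Finset.mem_filter.2 ⟨hU, hxU⟩

theorem sum_card_cliquesThrough (H : SimpleGraph α) (k : ℕ) (T : Finset α) :
    ∑ x ∈ T, (cliquesThrough H k T x).card = (k + 1) * (cliquesIn H k T).card := by
  simp only [cliquesThrough, Finset.card_filter]
  rw [Finset.sum_comm, mul_comm, ← smul_eq_mul, ← Finset.sum_const]
  refine Finset.sum_congr rfl fun S hS => ?_
  obtain ⟨h1, h2, -⟩ := mem_cliquesIn.1 hS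
  rw [← Finset.card_filter, Finset.filter_mem_eq_inter, Finset.inter_eq_right.2 h1, h2]

/-- Removing `x` maps these cliques injectively to `k`-subsets of the neighbourhood of `x`, which
has at most j - 1 elements. -/
theorem card_cliquesThrough_le {H : SimpleGraph α} {T : Finset α} {j : ℕ} (hT : HasDegreeLT H T j)
    (k : ℕ) {x : α} (hx : x ∈ T) : (cliquesThrough H k T x).card ≤ (j - 1) ^ k := by
  classical
  have h1 : (cliquesThrough H k T x).card ≤
      ((T.filter fun y => H.Adj x y).powersetCard k).card := by
    refine Finset.card_le_card_of_injOn (fun S => S.erase x) (fun S hS => ?_) ?_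
    · obtain ⟨hS1, hxS⟩ := Finset.mem_filter.1 hS
      obtain ⟨hS2, hS3, hS4⟩ := mem_cliquesIn.1 hS1
      rw [Finset.mem_coe, Finset.mem_powersetCard]
      refine ⟨fun y hy => ?_, by rw [Finset.card_erase_of_mem hxS, hS3]; rfl⟩
      obtain ⟨hyx, hyS⟩ := Finset.mem_erase.1 hy
      exact Finset.mem_filter.2 ⟨hS2 hyS, hS4 hxS hyS hyx.symm⟩
    · intro S hS S' hS' h
      rw [← Finset.insert_erase (Finset.mem_filter.1 hS).2,
        ← Finset.insert_erase (Finset.mem_filter.1 hS').2]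
      exact congrArg _ h
  refine h1.trans ?_
  rw [Finset.card_powersetCard]
  convert (Nat.choose_le_pow _ k).trans (Nat.pow_le_pow_left (Nat.le_sub_one_of_lt (hT x hx)) k)

/-- Monotonicity of x ↦ (x - a)²/x on x ≥ a: it replaces the unknown clique count g ≥ b by b in the
exponent. -/
theorem sq_sub_div_le_sq_sub_div {a b g : ℝ} (ha : 0 ≤ a) (hab : a ≤ b) (hb : 0 < b)
    (hg : b ≤ g) : (b - a) ^ 2 / b ≤ (g - a) ^ 2 / g := by
  rw [div_le_div_iff₀ hb (hb.trans_le hg)]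
  have : (g - a) ^ 2 * b - (b - a) ^ 2 * g = (g - b) * (g * b - a ^ 2) := by ring
  have h2 : a ^ 2 ≤ g * b := by nlinarith
  nlinarith [mul_nonneg (sub_nonneg.2 hg) (sub_nonneg.2 h2)]

/-- Concentration of clique counts in random induced subgraphs. -/
theorem bernoulliWeight_cliquesIn_mul_le {p : α → ℝ} (hp0 : ∀ i, 0 ≤ p i) (hp1 : ∀ i, p i ≤ 1)
    (H : SimpleGraph α) (k : ℕ) {s : Finset α} {a b M : ℝ} (hab : a ≤ b) (hb : 0 < b) (hM : 0 < M)
    {A B : Finset (Finset α)} (hA : A ⊆ s.powerset) (hB : B ⊆ s.powerset)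
    (hAa : ∀ S ∈ A, ((cliquesIn H k S).card : ℝ) ≤ a)
    (hBb : ∀ T ∈ B, b ≤ (cliquesIn H k T).card)
    (hBM : ∀ T ∈ B, ∀ x ∈ T, ((cliquesThrough H k T x).card : ℝ) ≤ M) :
    (∑ S ∈ A, bernoulliWeight p s S) * ∑ T ∈ B, bernoulliWeight p s T ≤
      Real.exp (-((b - a) ^ 2 / b / (16 * (k + 1) * M))) := by
  have hw := bernoulliWeight_nonneg hp0 hp1 s
  rcases A.eq_empty_or_nonempty with rfl | hne
  · simpa using (Real.exp_pos _).le
  have ha : 0 ≤ a := by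
    obtain ⟨S, hS⟩ := hne
    exact (Nat.cast_nonneg _).trans (hAa S hS)
  obtain ⟨z, hz, hE⟩ := exists_convex_distance_vector hp0 hp1 s A hA hne
  set κ := (b - a) ^ 2 / b / (16 * (k + 1) * M) with hκ
  have key : ∀ T ∈ B, κ ≤ (∑ i ∈ T, z T i ^ 2) / 16 := by
    intro T hT
    obtain ⟨S, hS, hSle⟩ := hz T (Finset.mem_powerset.1 (hB hT))
      (fun x => ((cliquesThrough H k T x).card : ℝ)) (fun _ => Nat.cast_nonneg _)
    set g : ℝ := ((cliquesIn H k T).card : ℝ) with hg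
    have hbg : b ≤ g := hBb T hT
    have hg0 : 0 < g := hb.trans_le hbg
    have h1 : g - a ≤ ∑ i ∈ T, ((cliquesThrough H k T i).card : ℝ) * z T i := by
      have h2 : g ≤ (cliquesIn H k S).card +
          ∑ x ∈ T \ S, ((cliquesThrough H k T x).card : ℝ) := by
        rw [hg]
        exact_mod_cast card_cliquesIn_le H k T S
      have := hAa S hS
      linarith
    -- One factor of each square is bounded by M; the other sums to (k+1)g by double counting. The
    -- square norm is thus linear in g, the source of (b - a)²/b in the exponent.
    have h2 : ∑ i ∈ T, ((cliquesThrough H k T i).card : ℝ) ^ 2 ≤ M * ((k + 1) * g) := by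
      have h3 : ∑ i ∈ T, ((cliquesThrough H k T i).card : ℝ) = (k + 1) * g := by
        rw [hg]
        exact_mod_cast sum_card_cliquesThrough H k T
      rw [← h3, Finset.mul_sum]
      refine Finset.sum_le_sum fun i hi => ?_
      rw [sq]
      exact mul_le_mul_of_nonneg_right (hBM T hT i hi) (Nat.cast_nonneg _)
    have h4 : (g - a) ^ 2 ≤ M * ((k + 1) * g) * ∑ i ∈ T, z T i ^ 2 := by
      calc (g - a) ^ 2 ≤ (∑ i ∈ T, ((cliquesThrough H k T i).card : ℝ) * z T i) ^ 2 :=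
            pow_le_pow_left₀ (by linarith) h1 2
        _ ≤ (∑ i ∈ T, ((cliquesThrough H k T i).card : ℝ) ^ 2) * ∑ i ∈ T, z T i ^ 2 :=
            Finset.sum_mul_sq_le_sq_mul_sq _ _ _
        _ ≤ _ := mul_le_mul_of_nonneg_right h2 (Finset.sum_nonneg fun _ _ => sq_nonneg _)
    rw [hκ, div_le_div_iff₀ (by positivity) (by norm_num)]
    have h5 := sq_sub_div_le_sq_sub_div ha hab hb hbg
    have h6 : (g - a) ^ 2 / g ≤ M * (k + 1) * ∑ i ∈ T, z T i ^ 2 := by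
      rw [div_le_iff₀ hg0]
      linarith
    linarith
  have h1 : (∑ T ∈ B, bernoulliWeight p s T) * Real.exp κ ≤
      ∑ T ∈ s.powerset, bernoulliWeight p s T * Real.exp ((∑ i ∈ T, z T i ^ 2) / 16) := by
    rw [Finset.sum_mul]
    refine (Finset.sum_le_sum fun T hT =>
      mul_le_mul_of_nonneg_left (Real.exp_le_exp.2 (key T hT)) (hw T)).trans ?_
    exact Finset.sum_le_sum_of_subset_of_nonneg hB
      fun _ _ _ => mul_nonneg (hw _) (Real.exp_pos _).le
  have h2 := (mul_le_mul_of_nonneg_right h1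
    (Finset.sum_nonneg fun S (_ : S ∈ A) => hw S)).trans hE
  rw [Real.exp_neg, ← one_div, le_div_iff₀ (Real.exp_pos _)]
  linarith

variable {β : Type*} [DecidableEq β]

theorem cliquesIn_image {H : SimpleGraph α} {H' : SimpleGraph β} {φ : α → β} {T : Finset α}
    (hinj : Set.InjOn φ T) (hadj : ∀ x ∈ T, ∀ y ∈ T, H'.Adj (φ x) (φ y) ↔ H.Adj x y) (k : ℕ) :
    (cliquesIn H' k (T.image φ)).card = (cliquesIn H k T).card := by
  symm
  refine Finset.card_bij (fun S _ => S.image φ) ?_ ?_ ?_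
  · intro S hS
    obtain ⟨h1, h2, h3⟩ := mem_cliquesIn.1 hS
    refine mem_cliquesIn.2 ⟨Finset.image_subset_image h1, ?_, ?_⟩
    · rw [Finset.card_image_of_injOn (hinj.mono h1), h2]
    · intro v hv w hw hvw
      simp only [Finset.coe_image, Set.mem_image] at hv hw
      obtain ⟨x, hx, rfl⟩ := hv
      obtain ⟨y, hy, rfl⟩ := hw
      exact (hadj x (h1 hx) y (h1 hy)).2 (h3 hx hy fun h => hvw (h ▸ rfl))
  · intro S hS S' hS' h
    have h1 := (mem_cliquesIn.1 hS).1
    have h1' := (mem_cliquesIn.1 hS').1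
    have h2 : φ '' (S : Set α) = φ '' (S' : Set α) := by
      rw [← Finset.coe_image, ← Finset.coe_image, h]
    have := (hinj.image_eq_image_iff (Finset.coe_subset.2 h1) (Finset.coe_subset.2 h1')).1 h2
    exact_mod_cast this
  · intro S' hS'
    obtain ⟨h1, h2, h3⟩ := mem_cliquesIn.1 hS'
    obtain ⟨S, hST, rfl⟩ := Finset.subset_image_iff.1 h1
    have hST' : S ⊆ T := Finset.coe_subset.1 hST
    refine ⟨S, mem_cliquesIn.2 ⟨hST', ?_, ?_⟩, rfl⟩
    · rwa [Finset.card_image_of_injOn (hinj.mono hST)] at h2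
    · intro x hx y hy hxy
      refine (hadj x (hST hx) y (hST hy)).1 (h3 ?_ ?_ fun h => hxy (hinj (hST hx) (hST hy) h))
      · exact Finset.mem_coe.2 (Finset.mem_image_of_mem _ hx)
      · exact Finset.mem_coe.2 (Finset.mem_image_of_mem _ hy)

end Cliques

theorem hasDegreeLT_image {α β : Type*} [DecidableEq β] {H : SimpleGraph α} {H' : SimpleGraph β} {φ : α → β} {T : Finset α}
    (hinj : Set.InjOn φ T) (hadj : ∀ x ∈ T, ∀ y ∈ T, H'.Adj (φ x) (φ y) ↔ H.Adj x y) (j : ℕ) :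
    HasDegreeLT H' (T.image φ) j ↔ HasDegreeLT H T j := by
  classical
  simp only [HasDegreeLT, Finset.forall_mem_image]
  refine forall₂_congr fun x hx => ?_
  rw [Finset.filter_image, Finset.card_image_of_injOn (hinj.mono (Finset.filter_subset _ _))]
  have : ∀ y ∈ T, (H'.Adj (φ x) (φ y) ↔ H.Adj x y) := hadj x hx
  rw [Finset.filter_congr this]

/-! ### Occupied cells of a Poisson process -/

/-- If the indicators of measurable sets converge almost everywhere to the indicator of a set, then
the probabilities converge. -/
theorem tendsto_measureReal_of_ae_eventually_mem_iff {Ω : Type*} [MeasurableSpace Ω]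
    {P : Measure Ω} [IsFiniteMeasure P] {X : ℕ → Set Ω} {S : Set Ω} (hX : ∀ s, MeasurableSet (X s))
    (h : ∀ᵐ ω ∂P, ∀ᶠ s in atTop, (ω ∈ X s ↔ ω ∈ S)) :
    Tendsto (fun s => P.real (X s)) atTop (𝓝 (P.real S)) := by
  -- `S` is not assumed measurable, so it is replaced by the lower limit of the `X s`, which is
  -- measurable and agrees with it almost everywhere.
  set A : Set Ω := {ω | ∀ᶠ s in atTop, ω ∈ X s} with hA
  have hAm : MeasurableSet A := by
    have : A = ⋃ N, ⋂ s, ⋂ (_ : N ≤ s), X s := by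
      ext ω
      simp [hA, eventually_atTop]
    rw [this]
    exact MeasurableSet.iUnion fun N => MeasurableSet.iInter fun s => MeasurableSet.iInter
      fun _ => hX s
  have hAS : ∀ ω, (∀ᶠ s in atTop, (ω ∈ X s ↔ ω ∈ S)) → (ω ∈ A ↔ ω ∈ S) := by
    intro ω hω
    constructor
    · intro hωA
      obtain ⟨s, h1, h2⟩ := (hω.and (show ∀ᶠ s in atTop, ω ∈ X s from hωA)).exists
      exact h1.1 h2
    · intro hωS
      exact hω.mono fun s hs => hs.2 hωS
  have hae : A =ᵐ[P] S := by
    filter_upwards [h] with ω hω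
    exact propext (hAS ω hω)
  have h1 : Tendsto (fun s => P (X s)) atTop (𝓝 (P A)) := by
    refine tendsto_measure_of_ae_tendsto_indicator_of_isFiniteMeasure atTop hAm hX ?_
    filter_upwards [h] with ω hω
    filter_upwards [hω] with s hs
    rw [hs, hAS ω hω]
  have h2 : P.real S = (P A).toReal := by rw [measureReal_def, measure_congr hae]
  rw [h2]
  exact (ENNReal.tendsto_toReal (measure_ne_top _ _)).comp h1

open Classical in
/-- The indices in `V` of the cells `C v` which contain points of `η`. -/
noncomputable def occupiedCells {E ι : Type*} (C : ι → Set E) (V : Finset ι) (η : Set E) :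
    Finset ι :=
  V.filter fun v => (η ∩ C v).Nonempty

theorem mem_occupiedCells {E ι : Type*} {C : ι → Set E} {V : Finset ι} {η : Set E} {v : ι} :
    v ∈ occupiedCells C V η ↔ v ∈ V ∧ (η ∩ C v).Nonempty := by
  classical
  rw [occupiedCells, Finset.mem_filter]

theorem occupiedCells_subset {E ι : Type*} (C : ι → Set E) (V : Finset ι) (η : Set E) :
    occupiedCells C V η ⊆ V := fun _ hv => (mem_occupiedCells.1 hv).1

section Occupied

variable {E Ω ι : Type*} [TopologicalSpace E] [MeasurableSpace E] [MeasurableSpace Ω]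
  {P : Measure Ω} {μ : Measure E} {η : Ω → Set E}

theorem IsPoissonProcess.measurableSet_nonempty (h : IsPoissonProcess P μ η) {A : Set E}
    (hA : MeasurableSet A) : MeasurableSet {ω | (η ω ∩ A).Nonempty} := by
  have : {ω | (η ω ∩ A).Nonempty} = (fun ω => (η ω ∩ A).encard) ⁻¹' {0}ᶜ := by
    ext ω
    simp [Set.nonempty_iff_ne_empty]
  rw [this]
  exact h.measurable_count A hA MeasurableSet.of_discrete

theorem IsPoissonProcess.measurableSet_occupiedCells (h : IsPoissonProcess P μ η) {C : ι → Set E}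
    (hC : ∀ v, MeasurableSet (C v)) (V : Finset ι) (T : Finset ι) :
    MeasurableSet {ω | occupiedCells C V (η ω) = T} := by
  by_cases hT : T ⊆ V
  · have : {ω | occupiedCells C V (η ω) = T} =
        ⋂ v ∈ V, {ω | (η ω ∩ C v).Nonempty ↔ v ∈ T} := by
      ext ω
      simp only [Set.mem_ofPred_eq, Set.mem_iInter, Finset.ext_iff, mem_occupiedCells]
      constructor
      · intro h v hv
        rw [← h v]
        simp [hv]
      · intro h v
        by_cases hv : v ∈ V
        · simp [hv, h v hv]
        · exact iff_of_false (fun h => hv h.1) fun h => hv (hT h)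
    rw [this]
    refine Finset.measurableSet_biInter _ fun v _ => ?_
    by_cases hv : v ∈ T
    · simpa [hv] using h.measurableSet_nonempty (hC v)
    · simpa [hv, Set.compl_ofPred, Set.not_nonempty_iff_eq_empty] using
        (h.measurableSet_nonempty (hC v)).compl
  · convert MeasurableSet.empty
    ext ω
    simp only [Set.mem_ofPred_eq, Set.mem_empty_iff_false, iff_false]
    rintro rfl
    exact hT (occupiedCells_subset _ _ _)

/-- Counts in disjoint cells are independent, so occupied cells form a random subset with
independent inclusions, to which the convex distance inequality applies. -/
theorem IsPoissonProcess.measureReal_occupiedCells_eq [DecidableEq ι] [IsProbabilityMeasure P]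
    (h : IsPoissonProcess P μ η) {C : ι → Set E} (hC : ∀ v, MeasurableSet (C v))
    (hdisj : Pairwise fun v w => Disjoint (C v) (C w)) {V T : Finset ι} (hT : T ⊆ V) :
    P.real {ω | occupiedCells C V (η ω) = T} =
      bernoulliWeight (fun v => P.real {ω | (η ω ∩ C v).Nonempty}) V T := by
  set e := V.equivFin with he
  set A : Fin V.card → Set E := fun i => C (e.symm i) with hA
  have hind := h.indep_count V.card A (fun i => hC _)
    (fun i j hij => hdisj fun h => hij (e.symm.injective (Subtype.ext h)))
  set sets : Fin V.card → Set ℕ∞ := fun i => if ((e.symm i : V) : ι) ∈ T then {0}ᶜ else {0}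
    with hsets
  have h1 := hind.measure_inter_preimage_eq_mul Finset.univ (sets := sets)
    (fun _ _ => MeasurableSet.of_discrete)
  have h2 : {ω | occupiedCells C V (η ω) = T} =
      ⋂ i ∈ (Finset.univ : Finset (Fin V.card)), (fun ω => (η ω ∩ A i).encard) ⁻¹' sets i := by
    ext ω
    simp only [Set.mem_ofPred_eq, Set.mem_iInter, Finset.ext_iff, mem_occupiedCells,
      Finset.mem_univ, forall_true_left, Set.mem_preimage]
    have h3 : ∀ i, ((η ω ∩ A i).encard ∈ sets i ↔
        ((η ω ∩ C (e.symm i)).Nonempty ↔ ((e.symm i : V) : ι) ∈ T)) := by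
      intro i
      by_cases hi : ((e.symm i : V) : ι) ∈ T
      · simp [hsets, hi, hA, Set.nonempty_iff_ne_empty]
      · simp [hsets, hi, hA, Set.not_nonempty_iff_eq_empty]
    simp only [h3]
    constructor
    · intro h i
      rw [← h]
      simp
    · intro h v
      by_cases hv : v ∈ V
      · have := h (e ⟨v, hv⟩)
        simp only [Equiv.symm_apply_apply] at this
        simp [hv, this]
      · exact iff_of_false (fun h => hv h.1) fun h => hv (hT h)
  rw [measureReal_def, h2, h1, ENNReal.toReal_prod, bernoulliWeight, ← Finset.prod_coe_sort V,
    ← Equiv.prod_comp e.symm]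
  refine Finset.prod_congr rfl fun i _ => ?_
  by_cases hi : ((e.symm i : V) : ι) ∈ T
  · rw [if_pos hi, measureReal_def]
    congr 2
    ext ω
    simp [hsets, hi, hA, Set.nonempty_iff_ne_empty]
  · rw [if_neg hi, ← probReal_compl_eq_one_sub (h.measurableSet_nonempty (hC _)), measureReal_def]
    congr 2
    ext ω
    simp [hsets, hi, hA, Set.not_nonempty_iff_eq_empty]

theorem IsPoissonProcess.measureReal_occupiedCells_mem [DecidableEq ι] [IsProbabilityMeasure P]
    (h : IsPoissonProcess P μ η) {C : ι → Set E} (hC : ∀ v, MeasurableSet (C v))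
    (hdisj : Pairwise fun v w => Disjoint (C v) (C w)) {V : Finset ι} {A : Finset (Finset ι)}
    (hA : A ⊆ V.powerset) :
    P.real {ω | occupiedCells C V (η ω) ∈ A} =
      ∑ T ∈ A, bernoulliWeight (fun v => P.real {ω | (η ω ∩ C v).Nonempty}) V T := by
  have h1 : {ω | occupiedCells C V (η ω) ∈ A} =
      ⋃ T ∈ A, {ω | occupiedCells C V (η ω) = T} := by
    ext ω
    simp
  rw [h1, measureReal_biUnion_finset]
  · exact Finset.sum_congr rfl fun T hT =>
      h.measureReal_occupiedCells_eq hC hdisj (Finset.mem_powerset.1 (hA hT))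
  · intro T _ T' _ hTT'
    rw [Function.onFun, Set.disjoint_left]
    rintro ω rfl h2
    exact hTT' h2
  · exact fun T _ => h.measurableSet_occupiedCells hC V T

theorem IsPoissonProcess.measurableSet_occupiedCells_prop (h : IsPoissonProcess P μ η)
    {C : ι → Set E} (hC : ∀ v, MeasurableSet (C v)) (V : Finset ι) (p : Finset ι → Prop) :
    MeasurableSet {ω | p (occupiedCells C V (η ω))} := by
  classical
  have h1 : {ω | p (occupiedCells C V (η ω))} =
      ⋃ T ∈ V.powerset.filter p, {ω | occupiedCells C V (η ω) = T} := by
    ext ω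
    simp only [Set.mem_ofPred_eq, Set.mem_iUnion, Finset.mem_filter, Finset.mem_powerset,
      exists_prop]
    constructor
    · exact fun hp => ⟨_, ⟨occupiedCells_subset _ _ _, hp⟩, rfl⟩
    · rintro ⟨T, ⟨-, hp⟩, rfl⟩
      exact hp
  rw [h1]
  exact Finset.measurableSet_biUnion _ fun T _ => h.measurableSet_occupiedCells hC V T

/-- Concentration of the clique count of a graph on the set of occupied cells. -/
theorem IsPoissonProcess.occupiedCells_cliquesIn_mul_le [DecidableEq ι] [IsProbabilityMeasure P]
    (h : IsPoissonProcess P μ η) {C : ι → Set E} (hC : ∀ v, MeasurableSet (C v))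
    (hdisj : Pairwise fun v w => Disjoint (C v) (C w)) (V : Finset ι) (H : SimpleGraph ι)
    {k j : ℕ} {a b M : ℝ} (hab : a ≤ b) (hb : 0 < b) (hM : 0 < M)
    (hjM : ((j - 1 : ℕ) : ℝ) ^ k ≤ M) :
    P.real {ω | ((cliquesIn H k (occupiedCells C V (η ω))).card : ℝ) ≤ a} *
      P.real {ω | b ≤ ((cliquesIn H k (occupiedCells C V (η ω))).card : ℝ) ∧
        HasDegreeLT H (occupiedCells C V (η ω)) j} ≤
      Real.exp (-((b - a) ^ 2 / b / (16 * (k + 1) * M))) := by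
  classical
  have h1 := h.measureReal_occupiedCells_mem hC hdisj (V := V)
    (A := V.powerset.filter fun T => ((cliquesIn H k T).card : ℝ) ≤ a) (Finset.filter_subset _ _)
  have h2 := h.measureReal_occupiedCells_mem hC hdisj (V := V)
    (A := V.powerset.filter fun T => b ≤ ((cliquesIn H k T).card : ℝ) ∧ HasDegreeLT H T j)
    (Finset.filter_subset _ _)
  simp only [Finset.mem_filter, Finset.mem_powerset, occupiedCells_subset, true_and] at h1 h2
  rw [h1, h2]
  refine bernoulliWeight_cliquesIn_mul_le (fun _ => measureReal_nonneg)
    (fun _ => measureReal_le_one) H k hab hb hM (Finset.filter_subset _ _)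
    (Finset.filter_subset _ _) (fun S hS => (Finset.mem_filter.1 hS).2)
    (fun T hT => (Finset.mem_filter.1 hT).2.1) fun T hT x hx => ?_
  refine le_trans ?_ hjM
  exact_mod_cast card_cliquesThrough_le (Finset.mem_filter.1 hT).2.2 k hx

end Occupied

/-! ### From cells to points: refining the mesh -/

theorem faceCount_coe {E : Type*} [PseudoMetricSpace E] [DecidableEq E] (T : Finset E) (r : ℝ)
    (k : ℕ) :
    faceCount (T : Set E) r k = ((cliquesIn (gilbertGraph Set.univ r) k T).card : ℝ) := by
  have : vietorisRipsFaces (T : Set E) r k = (cliquesIn (gilbertGraph Set.univ r) k T : Set _) := by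
    ext S
    rw [Finset.mem_coe, mem_cliquesIn]
    constructor
    · rintro ⟨h1, h2, h3⟩
      refine ⟨Finset.coe_subset.1 h1, h2, fun x hx y hy hxy => ?_⟩
      have := h3 hx hy hxy
      exact ⟨Set.mem_univ _, Set.mem_univ _, this.2.2⟩
    · rintro ⟨h1, h2, h3⟩
      refine ⟨Finset.coe_subset.2 h1, h2, fun x hx y hy hxy => ?_⟩
      have := h3 hx hy hxy
      exact ⟨h1 hx, h1 hy, this.2.2⟩
  rw [faceCount, this, Set.ncard_coe_finset]

/-- The index of the half-open cube of side length `r` which contains `x`. -/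
noncomputable def cubeIndex {d : ℕ} (r : ℝ) (x : EuclideanSpace ℝ (Fin d)) : Fin d → ℤ :=
  fun i => ⌊x i / r⌋

theorem measurable_cubeIndex {d : ℕ} (r : ℝ) :
    Measurable (cubeIndex r : EuclideanSpace ℝ (Fin d) → Fin d → ℤ) := by
  refine measurable_pi_lambda _ fun i => Int.measurable_floor.comp ?_
  fun_prop

theorem EuclideanSpace.dist_le_of_forall_abs_sub_le {d : ℕ} {x y : EuclideanSpace ℝ (Fin d)} {c : ℝ}
    (hc : 0 ≤ c) (h : ∀ i, |x i - y i| ≤ c) : dist x y ≤ d * c := by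
  rw [EuclideanSpace.dist_eq]
  refine Real.sqrt_le_iff.2 ⟨by positivity, ?_⟩
  have h1 : ∑ i, dist (x i) (y i) ^ 2 ≤ ∑ _i : Fin d, c ^ 2 :=
    Finset.sum_le_sum fun i _ => pow_le_pow_left₀ dist_nonneg (h i) 2
  refine h1.trans ?_
  rw [Finset.sum_const, Finset.card_univ, Fintype.card_fin, nsmul_eq_mul, mul_pow]
  refine mul_le_mul_of_nonneg_right ?_ (sq_nonneg c)
  exact_mod_cast Nat.le_self_pow two_ne_zero d

theorem dist_le_of_cubeIndex_eq {d : ℕ} {r : ℝ} (hr : 0 < r) {x y : EuclideanSpace ℝ (Fin d)}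
    (h : cubeIndex r x = cubeIndex r y) : dist x y ≤ d * r := by
  refine EuclideanSpace.dist_le_of_forall_abs_sub_le hr.le fun i => ?_
  have h1 := Int.abs_sub_lt_one_of_floor_eq_floor (congrFun h i)
  rw [← sub_div, abs_div, abs_of_pos hr, div_lt_one hr] at h1
  exact h1.le

theorem finite_image_cubeIndex {d : ℕ} {r : ℝ} (hr : 0 < r) {W : Set (EuclideanSpace ℝ (Fin d))}
    (hW : Bornology.IsBounded W) : (cubeIndex r '' W).Finite := by
  obtain ⟨R, hR⟩ := hW.exists_norm_le
  refine (Set.finite_Icc (fun _ : Fin d => ⌊-R / r⌋) (fun _ => ⌊R / r⌋)).subset ?_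
  rintro _ ⟨x, hx, rfl⟩
  have h1 : ∀ i, |x i| ≤ R := fun i => (PiLp.norm_apply_le x i).trans (hR x hx)
  refine ⟨fun i => Int.floor_le_floor ?_, fun i => Int.floor_le_floor ?_⟩
  · exact div_le_div_of_nonneg_right (abs_le.1 (h1 i)).1 hr.le
  · exact div_le_div_of_nonneg_right (abs_le.1 (h1 i)).2 hr.le

/-- The graph on the images of points under `φ`: different images are joined if they contain points
at distance at most `r`. -/
def quotientGilbertGraph {E ι : Type*} [PseudoMetricSpace E] (φ : E → ι) (r : ℝ) :
    SimpleGraph ι where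
  Adj v w := v ≠ w ∧ ∃ x y, φ x = v ∧ φ y = w ∧ dist x y ≤ r
  symm := ⟨fun _ _ h => ⟨h.1.symm, by
    obtain ⟨x, y, hx, hy, hxy⟩ := h.2
    exact ⟨y, x, hy, hx, dist_comm x y ▸ hxy⟩⟩⟩
  loopless := ⟨fun _ h => h.1 rfl⟩

/-- If the fibres of the maps `φ s` shrink, then they eventually embed the Gilbert graph of a finite
point set. -/
theorem eventually_quotientGilbertGraph {E ι : Type*} [MetricSpace E] {φ : ℕ → E → ι}
    {ε : ℕ → ℝ} (hε : Tendsto ε atTop (𝓝 0))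
    (hφ : ∀ s x y, φ s x = φ s y → dist x y ≤ ε s) (T : Finset E) (r : ℝ) :
    ∀ᶠ s in atTop, Set.InjOn (φ s) T ∧ ∀ x ∈ T, ∀ y ∈ T,
      ((quotientGilbertGraph (φ s) r).Adj (φ s x) (φ s y) ↔
        (gilbertGraph Set.univ r).Adj x y) := by
  have h1 : ∀ x y : E, ∀ᶠ s in atTop, (φ s x = φ s y → x = y) ∧
      ((quotientGilbertGraph (φ s) r).Adj (φ s x) (φ s y) ↔
        (gilbertGraph Set.univ r).Adj x y) := by
    intro x y
    by_cases hxy : x = y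
    · subst hxy
      exact Eventually.of_forall fun s => ⟨fun _ => rfl, by simp⟩
    have h2 : ∀ᶠ s in atTop, φ s x ≠ φ s y := by
      filter_upwards [hε.eventually_lt_const (dist_pos.2 hxy)] with s hs h
      exact absurd (hφ s x y h) (not_le.2 hs)
    by_cases hr : dist x y ≤ r
    · filter_upwards [h2] with s hs
      exact ⟨fun h => absurd h hs, iff_of_true ⟨hs, x, y, rfl, rfl, hr⟩
        ⟨Set.mem_univ _, Set.mem_univ _, hxy, hr⟩⟩
    · rw [not_le] at hr
      -- Cells joined in the quotient graph have all their points within r + 2ε of each other, which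
      -- eventually excludes a pair at distance strictly greater than r.
      have h3 : Tendsto (fun s => r + 2 * ε s) atTop (𝓝 (r + 2 * 0)) :=
        tendsto_const_nhds.add (hε.const_mul 2)
      rw [mul_zero, add_zero] at h3
      filter_upwards [h2, h3.eventually_lt_const hr] with s hs hs'
      refine ⟨fun h => absurd h hs, iff_of_false ?_ fun h => absurd h.2.2.2 (not_le.2 hr)⟩
      rintro ⟨-, x', y', hx', hy', hd⟩
      have h4 := hφ s x x' hx'.symm
      have h5 := hφ s y' y hy'
      have h6 := dist_triangle4 x x' y' y
      linarith
  have h2 : ∀ᶠ s in atTop, ∀ x ∈ T, ∀ y ∈ T, (φ s x = φ s y → x = y) ∧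
      ((quotientGilbertGraph (φ s) r).Adj (φ s x) (φ s y) ↔
        (gilbertGraph Set.univ r).Adj x y) := by
    rw [Finset.eventually_all]
    intro x _
    rw [Finset.eventually_all]
    exact fun y _ => h1 x y
  filter_upwards [h2] with s hs
  exact ⟨fun x hx y hy h => (hs x hx y hy).1 h, fun x hx y hy => (hs x hx y hy).2⟩

theorem occupiedCells_preimage_eq_image {E ι : Type*} [DecidableEq ι] {φ : E → ι} {V : Finset ι}
    {T : Finset E} (hT : ∀ x ∈ T, φ x ∈ V) :
    occupiedCells (fun v => φ ⁻¹' {v}) V (T : Set E) = T.image φ := by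
  ext v
  rw [mem_occupiedCells, Finset.mem_image]
  constructor
  · rintro ⟨-, x, hx, rfl⟩
    exact ⟨x, hx, rfl⟩
  · rintro ⟨x, hx, rfl⟩
    exact ⟨hT x hx, x, hx, rfl⟩

/-- All degrees of the Gilbert graph of a point set are less than `j`. -/
def GilbertDegreeLT {E : Type*} [PseudoMetricSpace E] (η : Set E) (r : ℝ) (j : ℕ) : Prop :=
  ∀ T : Finset E, (T : Set E) = η → HasDegreeLT (gilbertGraph Set.univ r) T j

theorem gilbertDegreeLT_coe {E : Type*} [PseudoMetricSpace E] {T : Finset E} {r : ℝ} {j : ℕ} :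
    GilbertDegreeLT (T : Set E) r j ↔ HasDegreeLT (gilbertGraph Set.univ r) T j := by
  refine ⟨fun h => h T rfl, fun h T' hT' => ?_⟩
  rw [Finset.coe_injective hT']
  exact h

/-- A Poisson process has almost surely no points outside of the compact set that carries its
intensity measure, and finitely many points inside. -/
theorem IsPoissonProcess.ae_exists_finset {E Ω : Type*} [TopologicalSpace E] [T2Space E]
    [MeasurableSpace E] [BorelSpace E] [MeasurableSpace Ω] {P : Measure Ω} {μ : Measure E}
    {η : Ω → Set E} (h : IsPoissonProcess P μ η) {W : Set E} (hW : IsCompact W) (hμ : μ Wᶜ = 0) :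
    ∀ᵐ ω ∂P, ∃ T : Finset E, η ω = T ∧ (T : Set E) ⊆ W := by
  have hm : MeasurableSet Wᶜ := hW.measurableSet.compl
  have h1 := h.law_count Wᶜ hm (by simp [hμ])
  have h2 : P {ω | (η ω ∩ Wᶜ).encard ∈ ({0}ᶜ : Set ℕ∞)} = 0 := by
    have h3 := DFunLike.congr_fun h1 ({0}ᶜ : Set ℕ∞)
    rw [Measure.map_apply (h.measurable_count _ hm) MeasurableSet.of_discrete,
      Measure.map_apply Measurable.of_discrete MeasurableSet.of_discrete, hμ] at h3
    rw [show {ω | (η ω ∩ Wᶜ).encard ∈ ({0}ᶜ : Set ℕ∞)} =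
      (fun ω => (η ω ∩ Wᶜ).encard) ⁻¹' {0}ᶜ from rfl, h3]
    have h4 := prob_compl_eq_zero_iff (μ := poissonMeasure (0 : ℝ≥0∞).toNNReal)
      (s := {0}) (MeasurableSet.singleton _)
    have h5 : (Nat.cast : ℕ → ℕ∞) ⁻¹' {0}ᶜ = {0}ᶜ := by ext n; simp
    rw [h5, h4, poissonMeasure_singleton]
    simp
  have h3 : ∀ᵐ ω ∂P, (η ω ∩ Wᶜ).encard = 0 := by
    rw [ae_iff]
    exact h2
  filter_upwards [h3] with ω hω
  rw [Set.encard_eq_zero, ← Set.sdiff_eq, Set.sdiff_eq_empty] at hω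
  have hfin := h.locallyFinite ω W hW
  rw [Set.inter_eq_left.2 hω] at hfin
  exact ⟨hfin.toFinset, by simp, by simpa using hω⟩

/-- Concentration of the number of faces of the Vietoris–Rips complex, on the event that the degrees
of the Gilbert graph are bounded. -/
theorem IsPoissonProcess.faceCount_mul_le {d : ℕ} {Ω : Type*} [MeasurableSpace Ω] {P : Measure Ω}
    [IsProbabilityMeasure P] {μ : Measure (EuclideanSpace ℝ (Fin d))}
    {η : Ω → Set (EuclideanSpace ℝ (Fin d))} (h : IsPoissonProcess P μ η)
    {W : Set (EuclideanSpace ℝ (Fin d))} (hW : IsCompact W) (hμ : μ Wᶜ = 0) (r : ℝ) {k j : ℕ}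
    {a b M : ℝ} (hab : a ≤ b) (hb : 0 < b) (hM : 0 < M) (hjM : ((j - 1 : ℕ) : ℝ) ^ k ≤ M) :
    P.real {ω | faceCount (η ω) r k ≤ a} *
      P.real {ω | b ≤ faceCount (η ω) r k ∧ GilbertDegreeLT (η ω) r j} ≤
      Real.exp (-((b - a) ^ 2 / b / (16 * (k + 1) * M))) := by
  classical
  set ρ : ℕ → ℝ := fun s => 1 / ((s : ℝ) + 1) with hρ
  have hρ0 : ∀ s, 0 < ρ s := fun s => by positivity
  set φ : ℕ → EuclideanSpace ℝ (Fin d) → Fin d → ℤ := fun s => cubeIndex (ρ s) with hφ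
  set V : ℕ → Finset (Fin d → ℤ) := fun s => (finite_image_cubeIndex (hρ0 s) hW.isBounded).toFinset
    with hV
  set C : ℕ → (Fin d → ℤ) → Set (EuclideanSpace ℝ (Fin d)) := fun s v => φ s ⁻¹' {v} with hCdef
  have hC : ∀ s v, MeasurableSet (C s v) := fun s v =>
    measurable_cubeIndex _ (MeasurableSet.singleton v)
  have hdisj : ∀ s, Pairwise fun v w => Disjoint (C s v) (C s w) := fun s v w hvw =>
    Disjoint.preimage _ (Set.disjoint_singleton.2 hvw)
  set H : ℕ → SimpleGraph (Fin d → ℤ) := fun s => quotientGilbertGraph (φ s) r with hH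
  have hlim : ∀ᵐ ω ∂P, ∀ᶠ s in atTop,
      ((cliquesIn (H s) k (occupiedCells (C s) (V s) (η ω))).card : ℝ) = faceCount (η ω) r k ∧
      (HasDegreeLT (H s) (occupiedCells (C s) (V s) (η ω)) j ↔ GilbertDegreeLT (η ω) r j) := by
    -- The required mesh depends on ω, so only almost sure eventual equality is available; this
    -- suffices for convergence of the probabilities.
    filter_upwards [h.ae_exists_finset hW hμ] with ω ⟨T, hT, hTW⟩
    have hε : Tendsto (fun s => d * ρ s) atTop (𝓝 0) := by
      have := (tendsto_one_div_add_atTop_nhds_zero_nat (𝕜 := ℝ)).const_mul (d : ℝ)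
      rwa [mul_zero] at this
    filter_upwards [eventually_quotientGilbertGraph hε
      (fun s x y hxy => dist_le_of_cubeIndex_eq (hρ0 s) hxy) T r] with s ⟨hs1, hs2⟩
    have h1 : occupiedCells (C s) (V s) (η ω) = T.image (φ s) := by
      rw [hT]
      refine occupiedCells_preimage_eq_image fun x hx => ?_
      rw [hV, Set.Finite.mem_toFinset]
      exact ⟨x, hTW hx, rfl⟩
    rw [h1, hT, faceCount_coe, gilbertDegreeLT_coe]
    exact ⟨congrArg _ (cliquesIn_image hs1 hs2 k), hasDegreeLT_image hs1 hs2 j⟩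
  have hA := tendsto_measureReal_of_ae_eventually_mem_iff
    (S := {ω | faceCount (η ω) r k ≤ a}) (P := P)
    (fun s => h.measurableSet_occupiedCells_prop (hC s) (V s)
      fun T => ((cliquesIn (H s) k T).card : ℝ) ≤ a)
    (by
      filter_upwards [hlim] with ω hω
      filter_upwards [hω] with s hs
      simp only [hs.1])
  have hB := tendsto_measureReal_of_ae_eventually_mem_iff
    (S := {ω | b ≤ faceCount (η ω) r k ∧ GilbertDegreeLT (η ω) r j}) (P := P)
    (fun s => h.measurableSet_occupiedCells_prop (hC s) (V s)
      fun T => b ≤ ((cliquesIn (H s) k T).card : ℝ) ∧ HasDegreeLT (H s) T j)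
    (by
      filter_upwards [hlim] with ω hω
      filter_upwards [hω] with s hs
      simp only [hs.1, hs.2])
  exact le_of_tendsto' (hA.mul hB) fun s =>
    h.occupiedCells_cliquesIn_mul_le (hC s) (hdisj s) (V s) (H s) hab hb hM hjM

/-! ### Poisson tails and the maximal degree -/

/-- Since m! j! ≤ (m+j)!, the mass at m + j is at most λ^j/j! times the mass at m; sum over m. -/
theorem poissonMeasure_setOf_le_le (l : ℝ≥0) (j : ℕ) :
    poissonMeasure l {n | j ≤ n} ≤ (l : ℝ≥0∞) ^ j / (j.factorial : ℝ≥0∞) := by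
  have h1 : {n : ℕ | j ≤ n} = ⋃ m : ℕ, {m + j} := by
    ext n
    simp only [Set.mem_ofPred_eq, Set.mem_iUnion, Set.mem_singleton_iff]
    exact ⟨fun h => ⟨n - j, (Nat.sub_add_cancel h).symm⟩, by rintro ⟨m, rfl⟩; omega⟩
  have h2 : ∀ m : ℕ, poissonMeasure l {m + j} ≤
      ENNReal.ofReal ((l : ℝ) ^ j / j.factorial) * poissonMeasure l {m} := by
    intro m
    rw [poissonMeasure_singleton, poissonMeasure_singleton, ← ENNReal.ofReal_mul (by positivity)]
    refine ENNReal.ofReal_le_ofReal ?_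
    have h3 : ((m.factorial : ℝ) * j.factorial) ≤ (m + j).factorial := by
      exact_mod_cast Nat.le_of_dvd (Nat.factorial_pos _) 
        (Nat.factorial_mul_factorial_dvd_factorial_add m j)
    calc Real.exp (-l) * (l : ℝ) ^ (m + j) / (m + j).factorial
        ≤ Real.exp (-l) * (l : ℝ) ^ (m + j) / (m.factorial * j.factorial) :=
          div_le_div_of_nonneg_left (by positivity) (by positivity) h3
      _ = _ := by rw [pow_add]; field_simp
  have h4 : ∑' m : ℕ, poissonMeasure l {m} = 1 := by
    have := Measure.tsum_indicator_apply_singleton (poissonMeasure l) Set.univ MeasurableSet.univ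
    simpa using this
  rw [h1]
  refine (measure_iUnion_le _).trans ((ENNReal.tsum_le_tsum h2).trans ?_)
  rw [ENNReal.tsum_mul_left, h4, mul_one, ENNReal.ofReal_div_of_pos (by positivity),
    ENNReal.ofReal_pow l.coe_nonneg, ENNReal.ofReal_natCast]
  simp

theorem IsPoissonProcess.measure_le_encard_le {E Ω : Type*} [TopologicalSpace E]
    [MeasurableSpace E] [MeasurableSpace Ω] {P : Measure Ω} {μ : Measure E} {η : Ω → Set E}
    (h : IsPoissonProcess P μ η) {A : Set E} (hA : MeasurableSet A) (hμ : μ A ≠ ∞) (j : ℕ) :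
    P {ω | (j : ℕ∞) ≤ (η ω ∩ A).encard} ≤ μ A ^ j / (j.factorial : ℝ≥0∞) := by
  have h1 := DFunLike.congr_fun (h.law_count A hA hμ) {n : ℕ∞ | (j : ℕ∞) ≤ n}
  rw [Measure.map_apply (h.measurable_count _ hA) MeasurableSet.of_discrete,
    Measure.map_apply Measurable.of_discrete MeasurableSet.of_discrete] at h1
  have h2 : (Nat.cast : ℕ → ℕ∞) ⁻¹' {n : ℕ∞ | (j : ℕ∞) ≤ n} = {n | j ≤ n} := by
    ext n
    simp
  rw [h2] at h1
  have h3 := poissonMeasure_setOf_le_le (μ A).toNNReal j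
  rw [← h1, ENNReal.coe_toNNReal hμ] at h3
  exact h3

/-- The union of the cubes of side length `r` which are adjacent to the cube with index `q`. -/
def cubeNeighborhood {d : ℕ} (r : ℝ) (q : Fin d → ℤ) : Set (EuclideanSpace ℝ (Fin d)) :=
  {x | ∀ i, |cubeIndex r x i - q i| ≤ 1}

theorem measurableSet_cubeNeighborhood {d : ℕ} (r : ℝ) (q : Fin d → ℤ) :
    MeasurableSet (cubeNeighborhood r q) := by
  have : cubeNeighborhood r q = cubeIndex r ⁻¹' {v | ∀ i, |v i - q i| ≤ 1} := rfl
  rw [this]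
  exact measurable_cubeIndex r (Set.to_countable _).measurableSet

theorem mem_cubeNeighborhood_of_dist_le {d : ℕ} {r : ℝ} (hr : 0 < r)
    {x y : EuclideanSpace ℝ (Fin d)} (h : dist x y ≤ r) :
    y ∈ cubeNeighborhood r (cubeIndex r x) := by
  intro i
  have h1 : |y i - x i| ≤ r := by
    rw [dist_comm, dist_eq_norm] at h
    exact (PiLp.norm_apply_le (y - x) i).trans h
  have h2 : |y i / r - x i / r| ≤ 1 := by
    rwa [← sub_div, abs_div, abs_of_pos hr, div_le_one hr]
  obtain ⟨h3, h4⟩ := abs_le.1 h2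
  rw [abs_le]
  constructor
  · have : ⌊x i / r⌋ ≤ ⌊y i / r⌋ + 1 := by
      rw [← Int.floor_add_one]
      exact Int.floor_le_floor (by linarith)
    change -1 ≤ ⌊y i / r⌋ - ⌊x i / r⌋
    linarith
  · have : ⌊y i / r⌋ ≤ ⌊x i / r⌋ + 1 := by
      rw [← Int.floor_add_one]
      exact Int.floor_le_floor (by linarith)
    change ⌊y i / r⌋ - ⌊x i / r⌋ ≤ 1
    linarith

theorem volume_cubeNeighborhood_le {d : ℕ} {r : ℝ} (hr : 0 < r) (q : Fin d → ℤ) :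
    volume (cubeNeighborhood r q) ≤ ENNReal.ofReal
      ((3 * d) ^ d * volume.real (Metric.ball (0 : EuclideanSpace ℝ (Fin d)) 1) * r ^ d) := by
  rcases (cubeNeighborhood r q).eq_empty_or_nonempty with h | ⟨x, hx⟩
  · simp [h]
  have hsub : cubeNeighborhood r q ⊆ Metric.closedBall x (d * (3 * r)) := by
    intro y hy
    refine EuclideanSpace.dist_le_of_forall_abs_sub_le (by positivity) fun i => ?_
    have h1 := abs_le.1 (hx i)
    have h2 := abs_le.1 (hy i)
    have h3 : |⌊y i / r⌋ - ⌊x i / r⌋| ≤ 2 := by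
      change (-1 ≤ ⌊x i / r⌋ - q i ∧ ⌊x i / r⌋ - q i ≤ 1) at h1
      change (-1 ≤ ⌊y i / r⌋ - q i ∧ ⌊y i / r⌋ - q i ≤ 1) at h2
      rw [abs_le]
      omega
    have h3' : |((⌊y i / r⌋ : ℝ) - ⌊x i / r⌋)| ≤ 2 := by exact_mod_cast h3
    have h4 : |y i / r - x i / r| ≤ 3 := by
      rw [abs_le] at h3' ⊢
      have := Int.floor_le (x i / r)
      have := Int.floor_le (y i / r)
      have := Int.lt_floor_add_one (x i / r)
      have := Int.lt_floor_add_one (y i / r)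
      constructor <;> linarith
    rwa [← sub_div, abs_div, abs_of_pos hr, div_le_iff₀ hr] at h4
  refine (measure_mono hsub).trans ?_
  rw [Measure.addHaar_closedBall _ _ (by positivity), finrank_euclideanSpace_fin,
    ← ENNReal.ofReal_toReal (measure_ball_lt_top (μ := volume)
      (x := (0 : EuclideanSpace ℝ (Fin d))) (r := 1)).ne, ← ENNReal.ofReal_mul (by positivity)]
  refine ENNReal.ofReal_le_ofReal (le_of_eq ?_)
  rw [measureReal_def]
  ring

/-- Each point lies in only as many blocks as there are offsets in {-1, 0, 1}^d, so the union bound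
over all cubes costs a multiple of the total mass, whatever the shape of the window. -/
theorem tsum_measure_cubeNeighborhood_le {d : ℕ} (r : ℝ)
    (μ : Measure (EuclideanSpace ℝ (Fin d))) :
    ∑' q, μ (cubeNeighborhood r q) ≤
      ((Finset.Icc (-1) 1 : Finset (Fin d → ℤ)).card : ℝ≥0∞) * μ Set.univ := by
  have h1 : ∀ q, μ (cubeNeighborhood r q) ≤
      ∑ v ∈ (Finset.Icc (-1) 1 : Finset (Fin d → ℤ)), μ (cubeIndex r ⁻¹' {q + v}) := by
    intro q
    refine le_trans (measure_mono fun x hx => ?_) (measure_biUnion_finset_le _ _)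
    rw [Set.mem_iUnion₂]
    refine ⟨cubeIndex r x - q, Finset.mem_Icc.2 ⟨fun i => (abs_le.1 (hx i)).1,
      fun i => (abs_le.1 (hx i)).2⟩, ?_⟩
    simp
  refine (ENNReal.tsum_le_tsum h1).trans ?_
  rw [Summable.tsum_finsetSum fun _ _ => ENNReal.summable]
  have h2 : ∀ v : Fin d → ℤ, ∑' q, μ (cubeIndex r ⁻¹' {q + v}) = μ Set.univ := by
    intro v
    refine ((Equiv.addRight v).tsum_eq (fun q => μ (cubeIndex r ⁻¹' {q}))).trans ?_
    rw [← measure_iUnion (fun q q' h => Disjoint.preimage _ (Set.disjoint_singleton.2 h))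
        fun q => measurable_cubeIndex r (MeasurableSet.singleton q)]
    congr 1
    ext x
    simp
  simp [h2]

/-- The tail of the maximal degree of the Gilbert graph of a Poisson process. -/
theorem IsPoissonProcess.measureReal_not_gilbertDegreeLT_le {d : ℕ} {Ω : Type*} [MeasurableSpace Ω]
    {P : Measure Ω} {μ : Measure (EuclideanSpace ℝ (Fin d))}
    {η : Ω → Set (EuclideanSpace ℝ (Fin d))} (h : IsPoissonProcess P μ η) {r t l : ℝ} (hr : 0 < r)
    (ht : 0 ≤ t) (hl : 0 ≤ l) (hμ : μ Set.univ = ENNReal.ofReal t)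
    (hμl : ∀ q, μ (cubeNeighborhood r q) ≤ ENNReal.ofReal l) (j : ℕ) :
    P.real {ω | ¬ GilbertDegreeLT (η ω) r (j + 1)} ≤
      (Finset.Icc (-1) 1 : Finset (Fin d → ℤ)).card * t * (l ^ j / (j + 1).factorial) := by
  classical
  have hsub : {ω | ¬ GilbertDegreeLT (η ω) r (j + 1)} ⊆
      ⋃ q, {ω | ((j + 1 : ℕ) : ℕ∞) ≤ (η ω ∩ cubeNeighborhood r q).encard} := by
    intro ω hω
    simp only [Set.mem_ofPred_eq, GilbertDegreeLT, HasDegreeLT, not_forall, not_lt] at hω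
    obtain ⟨T, hT, x, hx, hj⟩ := hω
    rw [Set.mem_iUnion]
    refine ⟨cubeIndex r x, ?_⟩
    refine (show ((j + 1 : ℕ) : ℕ∞) ≤ _ from Nat.cast_le.2 hj).trans ?_
    rw [← Set.encard_coe_eq_coe_finsetCard]
    refine Set.encard_le_encard fun y hy => ?_
    obtain ⟨hyT, hadj⟩ := Finset.mem_filter.1 (Finset.mem_coe.1 hy)
    exact ⟨hT ▸ hyT, mem_cubeNeighborhood_of_dist_le hr hadj.2.2.2⟩
  -- Of the j + 1 factors μ(block), j are bounded by l; the last is kept so that the sum over q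
  -- yields the factor t.
  have h1 : ∀ q, P {ω | ((j + 1 : ℕ) : ℕ∞) ≤ (η ω ∩ cubeNeighborhood r q).encard} ≤
      ENNReal.ofReal (l ^ j / (j + 1).factorial) * μ (cubeNeighborhood r q) := by
    intro q
    refine (h.measure_le_encard_le (measurableSet_cubeNeighborhood r q)
      ((hμl q).trans_lt ENNReal.ofReal_lt_top).ne (j + 1)).trans ?_
    rw [ENNReal.ofReal_div_of_pos (by positivity), ENNReal.ofReal_natCast, ENNReal.ofReal_pow hl,
      pow_succ, ENNReal.div_eq_inv_mul, ENNReal.div_eq_inv_mul, ← mul_assoc]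
    gcongr
    exact hμl q
  refine ENNReal.toReal_le_of_le_ofReal (by positivity) ?_
  refine (measure_mono hsub).trans ((measure_iUnion_le _).trans
    ((ENNReal.tsum_le_tsum h1).trans ?_))
  rw [ENNReal.tsum_mul_left]
  refine (mul_le_mul_right (tsum_measure_cubeNeighborhood_le r μ) _).trans ?_
  rw [hμ, ← ENNReal.ofReal_natCast, ← ENNReal.ofReal_mul (by positivity),
    ← ENNReal.ofReal_mul (by positivity)]
  exact ENNReal.ofReal_le_ofReal (le_of_eq (by ring))

/-! ### Truncation and the two tails around the median -/

theorem rpow_div_rpow_pow_eq {u v : ℝ} (hu : 0 ≤ u) (hv : 0 ≤ v) (k : ℕ) :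
    (u ^ (2 / ((k : ℝ) + 1)) / v ^ (1 / ((k : ℝ) + 1))) ^ (k + 1) = u ^ 2 / v := by
  have hk : ((k : ℝ) + 1) ≠ 0 := by positivity
  rw [div_pow, ← Real.rpow_natCast, ← Real.rpow_natCast, ← Real.rpow_mul hu, ← Real.rpow_mul hv]
  push_cast
  rw [div_mul_cancel₀ _ hk, div_mul_cancel₀ _ hk, Real.rpow_one, Real.rpow_two]

theorem exists_forall_mul_pow_div_factorial_le (κ l : ℝ) :
    ∃ N : ℕ, ∀ i, N ≤ i → κ * ((l * Real.exp 1) ^ i / i.factorial) ≤ 1 := by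
  have h := (FloorSemiring.tendsto_pow_div_factorial_atTop (l * Real.exp 1)).const_mul κ
  rw [mul_zero] at h
  obtain ⟨N, hN⟩ := eventually_atTop.1 (h.eventually_le_const zero_lt_one)
  exact ⟨N, hN⟩

/-- Replacing l by l·e in the factorial bound leaves a spare factor e^(-i). -/
theorem mul_pow_div_factorial_le_exp {κ l : ℝ} {i : ℕ}
    (h : κ * ((l * Real.exp 1) ^ i / i.factorial) ≤ 1) :
    κ * (l ^ i / i.factorial) ≤ Real.exp (-i) := by
  rw [mul_pow, ← Real.exp_nat_mul, mul_one] at h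
  rw [Real.exp_neg, ← one_div, le_div_iff₀ (Real.exp_pos _)]
  calc _ = κ * (l ^ i * Real.exp i / i.factorial) := by ring
    _ ≤ 1 := h

/-- Truncating at y/8 gains 8^k ≥ 8, enough to reach twice the target exponent. The resulting square
of the target bound absorbs the constants from the median. -/
theorem truncation_exponent_le {k : ℕ} (hk : 1 ≤ k) {y : ℝ} (hy : 0 < y) :
    2 * (1 / (4 * ((k : ℝ) + 1) ^ 2) * y) ≤ y ^ (k + 1) / (16 * (k + 1) * (y / 8) ^ k) := by
  have h8 : (8 : ℝ) ≤ 8 ^ k := by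
    calc (8 : ℝ) = 8 ^ 1 := by norm_num
      _ ≤ 8 ^ k := pow_le_pow_right₀ (by norm_num) hk
  have hk0 : (0 : ℝ) ≤ k := Nat.cast_nonneg k
  have h1 : y ^ (k + 1) / (16 * (k + 1) * (y / 8) ^ k) = y * 8 ^ k / (16 * (k + 1)) := by
    rw [div_pow, pow_succ]
    field_simp
  rw [h1, show 2 * (1 / (4 * ((k : ℝ) + 1) ^ 2) * y) = y / (2 * (k + 1) ^ 2) by
    field_simp; norm_num, div_le_div_iff₀ (by positivity) (by positivity)]
  have h2 : y * (16 * (k + 1)) ≤ y * 8 * (2 * (k + 1) ^ 2) := by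
    nlinarith [mul_nonneg hy.le hk0, mul_nonneg hy.le (mul_nonneg hk0 hk0)]
  refine h2.trans ?_
  gcongr

theorem faceCount_nonneg {E : Type*} [PseudoMetricSpace E] (η : Set E) (r : ℝ) (k : ℕ) :
    0 ≤ faceCount η r k := Nat.cast_nonneg _

theorem IsMedian.nonneg {Ω : Type*} [MeasurableSpace Ω] {P : Measure Ω} {X : Ω → ℝ} {m : ℝ}
    (h : IsMedian P X m) (hX : ∀ ω, 0 ≤ X ω) : 0 ≤ m := by
  by_contra hm
  have : {ω | X ω ≤ m} = ∅ := by
    ext ω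
    simp only [Set.mem_ofPred_eq, Set.mem_empty_iff_false, iff_false]
    intro h'
    linarith [hX ω]
  have h1 := h.1
  rw [this, measureReal_empty] at h1
  norm_num at h1

section Tails

variable {d : ℕ} {Ω : Type*} [MeasurableSpace Ω] {P : Measure Ω}
  {μ : Measure (EuclideanSpace ℝ (Fin d))} {η : Ω → Set (EuclideanSpace ℝ (Fin d))}

/-- If a `k`-face count is at least `x`, there are many points. -/
theorem IsPoissonProcess.measureReal_le_faceCount_le (h : IsPoissonProcess P μ η)
    {W : Set (EuclideanSpace ℝ (Fin d))} (hW : IsCompact W) (hμW : μ Wᶜ = 0) {t : ℝ} (ht : 0 ≤ t)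
    (hμ : μ Set.univ = ENNReal.ofReal t) {r x : ℝ} {k j : ℕ}
    (hx : ∀ n : ℕ, x ≤ n.choose (k + 1) → j ≤ n) :
    P.real {ω | x ≤ faceCount (η ω) r k} ≤ t ^ j / j.factorial := by
  classical
  have h1 : P {ω | x ≤ faceCount (η ω) r k} ≤ P {ω | (j : ℕ∞) ≤ (η ω ∩ Set.univ).encard} := by
    refine measure_mono_ae ?_
    filter_upwards [h.ae_exists_finset hW hμW] with ω ⟨T, hT, _⟩ hω
    change x ≤ faceCount (η ω) r k at hω
    change (j : ℕ∞) ≤ (η ω ∩ Set.univ).encard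
    rw [hT, faceCount_coe] at hω
    rw [hT, Set.inter_univ, Set.encard_coe_eq_coe_finsetCard]
    refine Nat.cast_le.2 (hx _ (hω.trans ?_))
    exact_mod_cast card_cliquesIn_le_choose _ k T
  have h2 := h1.trans (h.measure_le_encard_le MeasurableSet.univ (by simp [hμ]) j)
  refine ENNReal.toReal_le_of_le_ofReal (by positivity) (h2.trans (le_of_eq ?_))
  rw [hμ, ENNReal.ofReal_div_of_pos (by positivity), ENNReal.ofReal_natCast, ENNReal.ofReal_pow ht]

/-- Concentration around the median for processes with few points. -/
theorem IsPoissonProcess.concentration_of_lt_one [IsProbabilityMeasure P]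
    (h : IsPoissonProcess P μ η)
    {W : Set (EuclideanSpace ℝ (Fin d))} (hW : IsCompact W) (hμW : μ Wᶜ = 0) {t : ℝ} (ht : 0 ≤ t)
    (ht1 : t < 1) (hμ : μ Set.univ = ENNReal.ofReal t) {r m u y : ℝ} {k : ℕ} (hk : 1 ≤ k)
    (hm : IsMedian P (fun ω => faceCount (η ω) r k) m) (hu : 0 < u) (hy0 : 0 < y)
    (hy : y ^ (k + 1) = u ^ 2 / (u + m)) :
    P.real {ω | u ≤ |faceCount (η ω) r k - m|} ≤ t / (⌈y⌉₊).factorial := by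
  -- A positive median would need at least k + 1 ≥ 2 points with probability at least 1/2, but two
  -- points occur with probability at most t²/2 < 1/2.
  have hm0 : m = 0 := by
    by_contra hne
    have hmpos : 0 < m := lt_of_le_of_ne (hm.nonneg fun ω => faceCount_nonneg _ _ _) (Ne.symm hne)
    have h1 := h.measureReal_le_faceCount_le hW hμW ht hμ (r := r) (x := m) (k := k) (j := 2)
      (fun n hn => by
        by_contra hlt
        rw [Nat.choose_eq_zero_of_lt (by omega)] at hn
        push_cast at hn
        linarith)
    have h2 := hm.2.trans h1
    norm_num [Nat.factorial] at h2
    nlinarith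
  subst hm0
  have h1 : {ω | u ≤ |faceCount (η ω) r k - 0|} = {ω | u ≤ faceCount (η ω) r k} := by
    ext ω
    simp only [Set.mem_ofPred_eq]
    rw [sub_zero, abs_of_nonneg (faceCount_nonneg _ _ _)]
  have hyu : y ^ (k + 1) = u := by rw [hy, add_zero]; field_simp
  rw [h1]
  refine (h.measureReal_le_faceCount_le hW hμW ht hμ (j := ⌈y⌉₊) fun n hn => ?_).trans ?_
  · rw [Nat.ceil_le]
    have h2 : y ^ (k + 1) ≤ (n : ℝ) ^ (k + 1) := by
      rw [hyu]
      exact hn.trans (by exact_mod_cast Nat.choose_le_pow n (k + 1))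
    exact le_of_pow_le_pow_left₀ (Nat.succ_ne_zero k) (Nat.cast_nonneg n) h2
  · gcongr
    exact pow_le_of_le_one ht ht1.le (Nat.ceil_pos.2 hy0).ne'

/-- Concentration around the median for processes with many points. -/
theorem IsPoissonProcess.concentration_of_one_le [IsProbabilityMeasure P]
    (h : IsPoissonProcess P μ η)
    {W : Set (EuclideanSpace ℝ (Fin d))} (hW : IsCompact W) (hμW : μ Wᶜ = 0) {t : ℝ} (ht1 : 1 ≤ t)
    {r m u y : ℝ} {k j : ℕ} (hk : 1 ≤ k)
    (hm : IsMedian P (fun ω => faceCount (η ω) r k) m) (hu : 0 < u) (hy0 : 0 < y)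
    (hy : y ^ (k + 1) = u ^ 2 / (u + m)) (hj : ((j - 1 : ℕ) : ℝ) ≤ y / 8)
    (he : Real.exp (-(1 / (4 * ((k : ℝ) + 1) ^ 2) * y)) ≤ 1 / 2)
    (hq : P.real {ω | ¬ GilbertDegreeLT (η ω) r j} ≤
      t * Real.exp (-(1 / (4 * ((k : ℝ) + 1) ^ 2) * y))) :
    P.real {ω | u ≤ |faceCount (η ω) r k - m|} ≤
      4 * t * Real.exp (-(1 / (4 * ((k : ℝ) + 1) ^ 2) * y)) := by
  set e := Real.exp (-(1 / (4 * ((k : ℝ) + 1) ^ 2) * y)) with hedef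
  set q := P.real {ω | ¬ GilbertDegreeLT (η ω) r j} with hqdef
  have he0 : 0 < e := Real.exp_pos _
  have hm0 : 0 ≤ m := hm.nonneg fun ω => faceCount_nonneg _ _ _
  -- If q > 1/4, then t·e > 1/4 and the claimed bound exceeds 1.
  by_cases hq4 : 1 / 4 < q
  · refine measureReal_le_one.trans ?_
    linarith
  rw [not_lt] at hq4
  set M := (y / 8) ^ k with hMdef
  have hM : 0 < M := by positivity
  have hjM : ((j - 1 : ℕ) : ℝ) ^ k ≤ M := pow_le_pow_left₀ (Nat.cast_nonneg _) hj k
  have hexp : ∀ g, u ^ 2 / (u + m) ≤ g → Real.exp (-(g / (16 * (k + 1) * M))) ≤ e ^ 2 := by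
    intro g hg
    rw [hedef, ← Real.exp_nat_mul, Real.exp_le_exp]
    push_cast
    have h1 := truncation_exponent_le hk hy0
    have h2 : y ^ (k + 1) / (16 * (k + 1) * M) ≤ g / (16 * (k + 1) * M) := by
      rw [hy]
      gcongr
    linarith
  have hsplit : ∀ x, P.real {ω | x ≤ faceCount (η ω) r k} ≤
      P.real {ω | x ≤ faceCount (η ω) r k ∧ GilbertDegreeLT (η ω) r j} + q := by
    intro x
    refine le_trans (measureReal_mono fun ω hω => ?_) (measureReal_union_le _ _)
    by_cases hD : GilbertDegreeLT (η ω) r j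
    · exact Or.inl ⟨hω, hD⟩
    · exact Or.inr hD
  have hupper : P.real {ω | m + u ≤ faceCount (η ω) r k} ≤ 2 * e ^ 2 + q := by
    have h1 := h.faceCount_mul_le hW hμW r (a := m) (b := m + u) (by linarith) (by linarith) hM hjM
    have h2 := h1.trans (hexp _ (le_of_eq (by rw [add_sub_cancel_left, add_comm])))
    have h3 := mul_le_mul_of_nonneg_right hm.1 (measureReal_nonneg (μ := P)
      (s := {ω | m + u ≤ faceCount (η ω) r k ∧ GilbertDegreeLT (η ω) r j}))
    have h4 := hsplit (m + u)
    linarith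
  have hlower : P.real {ω | faceCount (η ω) r k ≤ m - u} ≤ 4 * e ^ 2 := by
    rcases lt_or_ge m u with hmu | hmu
    · have : {ω | faceCount (η ω) r k ≤ m - u} = ∅ := by
        ext ω
        simp only [Set.mem_ofPred_eq, Set.mem_empty_iff_false, iff_false]
        intro h'
        linarith [faceCount_nonneg (η ω) r k]
      rw [this, measureReal_empty]
      positivity
    · have hmpos : 0 < m := by linarith
      have h1 := h.faceCount_mul_le hW hμW r (a := m - u) (b := m) (by linarith) hmpos hM hjM
      have h2 := h1.trans (hexp _ (by
        rw [sub_sub_cancel]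
        gcongr
        linarith))
      have h3 := hm.2.trans (hsplit m)
      -- Truncation leaves at least 1/2 - 1/4 of the median event.
      have h4 : (1 / 4 : ℝ) ≤
          P.real {ω | m ≤ faceCount (η ω) r k ∧ GilbertDegreeLT (η ω) r j} := by linarith
      have h5 := mul_le_mul_of_nonneg_left h4 (measureReal_nonneg (μ := P)
        (s := {ω | faceCount (η ω) r k ≤ m - u}))
      linarith
  have hunion : P.real {ω | u ≤ |faceCount (η ω) r k - m|} ≤
      P.real {ω | m + u ≤ faceCount (η ω) r k} + P.real {ω | faceCount (η ω) r k ≤ m - u} := by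
    refine le_trans (measureReal_mono fun ω hω => ?_) (measureReal_union_le _ _)
    rcases le_abs.1 (show u ≤ |faceCount (η ω) r k - m| from hω) with h' | h'
    · exact Or.inl (show m + u ≤ _ by linarith)
    · exact Or.inr (show _ ≤ m - u by linarith)
  -- The total is at most 6e² + q. As e ≤ 1/2 and t ≥ 1, 6e² ≤ 3te, and q ≤ te: hence the constant
  -- 4.
  nlinarith

end Tails

/-! ### Choice of the constant and conclusion -/

theorem exists_faceCount_concentration_constant (d : ℕ) {k : ℕ} (hk : 1 ≤ k) {l : ℝ} (hl : 1 ≤ l) :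
    ∃ c : ℝ, 0 < c ∧
      ∀ W : Set (EuclideanSpace ℝ (Fin d)), IsCompact W → volume W = 1 →
      ∀ t r : ℝ, 0 < t → 0 < r →
      (∀ q, (ENNReal.ofReal t • volume.restrict W) (cubeNeighborhood r q) ≤ ENNReal.ofReal l) →
      ∀ (Ω : Type*) [MeasurableSpace Ω] (P : Measure Ω) [IsProbabilityMeasure P]
        (η : Ω → Set (EuclideanSpace ℝ (Fin d))),
        IsPoissonProcess P (ENNReal.ofReal t • volume.restrict W) η →
      ∀ m : ℝ, IsMedian P (fun ω => faceCount (η ω) r k) m →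
      ∀ u : ℝ, 0 ≤ u → c ≤ u ^ 2 / (u + m) →
        P.real {ω | u ≤ |faceCount (η ω) r k - m|} ≤
          4 * t * volume.real W *
            Real.exp (-(1 / (4 * ((k : ℝ) + 1) ^ 2) *
              (u ^ (2 / ((k : ℝ) + 1)) / (u + m) ^ (1 / ((k : ℝ) + 1))))) := by
  set κ : ℝ := (Finset.Icc (-1) 1 : Finset (Fin d → ℤ)).card + 1 with hκ
  have hκ1 : 1 ≤ κ := by
    rw [hκ]
    linarith [Nat.cast_nonneg (α := ℝ) (Finset.Icc (-1) 1 : Finset (Fin d → ℤ)).card]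
  obtain ⟨N, hN⟩ := exists_forall_mul_pow_div_factorial_le κ l
  -- 8N makes y/8 large enough for the factorial bound; 4(k+1)² makes the final exponent at least 1,
  -- so that its exponential is at most 1/2.
  set y₀ : ℝ := 8 * N + 8 + 4 * ((k : ℝ) + 1) ^ 2 with hy₀
  have hy₀pos : 0 < y₀ := by positivity
  refine ⟨y₀ ^ (k + 1), by positivity, ?_⟩
  intro W hW hW1 t r ht hr hμl Ω _ P _ η h m hm u hu hc
  have hm0 : 0 ≤ m := hm.nonneg fun ω => faceCount_nonneg _ _ _
  have hupos : 0 < u := by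
    rcases hu.lt_or_eq with h' | h'
    · exact h'
    · rw [← h'] at hc
      have : 0 < y₀ ^ (k + 1) := by positivity
      norm_num at hc
      linarith
  have hy := rpow_div_rpow_pow_eq hu (add_nonneg hu hm0) k
  set y := u ^ (2 / ((k : ℝ) + 1)) / (u + m) ^ (1 / ((k : ℝ) + 1)) with hydef
  have hy0 : 0 ≤ y := div_nonneg (Real.rpow_nonneg hu _) (Real.rpow_nonneg (add_nonneg hu hm0) _)
  have hyy : y₀ ≤ y := by
    rw [← hy] at hc
    exact le_of_pow_le_pow_left₀ (Nat.succ_ne_zero k) hy0 hc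
  have hypos : 0 < y := hy₀pos.trans_le hyy
  have hk0 : (1 : ℝ) ≤ k := by exact_mod_cast hk
  have hμW : (ENNReal.ofReal t • volume.restrict W) Wᶜ = 0 := by
    rw [Measure.smul_apply, Measure.restrict_apply hW.measurableSet.compl]
    simp
  have hμ : (ENNReal.ofReal t • volume.restrict W) Set.univ = ENNReal.ofReal t := by
    simp [hW1]
  have hWr : volume.real W = 1 := by rw [measureReal_def, hW1]; simp
  rw [hWr, mul_one]
  have hK : 1 / (4 * ((k : ℝ) + 1) ^ 2) ≤ 1 / 16 := by
    apply one_div_le_one_div_of_le (by norm_num)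
    nlinarith
  have hK0 : 0 ≤ 1 / (4 * ((k : ℝ) + 1) ^ 2) := by positivity
  have hexp : ∀ i : ℕ, y / 8 ≤ i → Real.exp (-i) ≤
      Real.exp (-(1 / (4 * ((k : ℝ) + 1) ^ 2) * y)) := by
    intro i hi
    refine Real.exp_le_exp.2 (neg_le_neg (le_trans ?_ hi))
    nlinarith
  have hNle : ∀ i : ℕ, y / 8 ≤ i → N ≤ i := by
    intro i hi
    have : (N : ℝ) ≤ i := by
      rw [hy₀] at hyy
      nlinarith
    exact_mod_cast this
  rcases lt_or_ge t 1 with ht1 | ht1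
  · refine (h.concentration_of_lt_one hW hμW ht.le ht1 hμ hk hm hupos hypos hy).trans ?_
    set i := ⌈y⌉₊ with hi
    have hyi : y / 8 ≤ i := le_trans (by linarith) (Nat.le_ceil y)
    have h1 := mul_pow_div_factorial_le_exp (hN i (hNle i hyi))
    have h2 : 1 / (i.factorial : ℝ) ≤ κ * (l ^ i / i.factorial) := by
      rw [mul_div_assoc']
      gcongr
      exact one_le_mul_of_one_le_of_one_le hκ1 (one_le_pow₀ hl)
    have h3 := h2.trans (h1.trans (hexp i hyi))
    have h4 := mul_le_mul_of_nonneg_left h3 ht.le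
    have h5 : 0 < t * Real.exp (-(1 / (4 * ((k : ℝ) + 1) ^ 2) * y)) := by positivity
    rw [mul_one_div] at h4
    linarith
  -- The degree threshold is j = i + 1 = ⌈y/8⌉: j - 1 ≤ y/8 controls the cliques through a vertex,
  -- and j ≥ y/8 gives the decay of the degree tail.
  · obtain ⟨i, hi⟩ : ∃ i, ⌈y / 8⌉₊ = i + 1 :=
      Nat.exists_eq_succ_of_ne_zero (Nat.ceil_pos.2 (by positivity)).ne'
    have hyi : y / 8 ≤ (i + 1 : ℕ) := by rw [← hi]; exact Nat.le_ceil _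
    refine h.concentration_of_one_le hW hμW ht1 (j := i + 1) hk hm hupos hypos hy ?_ ?_ ?_
    · have := Nat.ceil_lt_add_one (show 0 ≤ y / 8 by positivity)
      rw [hi] at this
      push_cast at this ⊢
      linarith
    · have h1 : 1 ≤ 1 / (4 * ((k : ℝ) + 1) ^ 2) * y := by
        rw [one_div, inv_mul_eq_div, one_le_div (by positivity)]
        have : (0 : ℝ) ≤ N := Nat.cast_nonneg N
        linarith
      refine (Real.exp_le_exp.2 (neg_le_neg h1)).trans ?_
      rw [Real.exp_neg, ← one_div]
      apply one_div_le_one_div_of_le (by norm_num)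
      have := Real.add_one_le_exp (1 : ℝ)
      linarith
    · refine (h.measureReal_not_gilbertDegreeLT_le hr ht.le (by linarith) hμ hμl i).trans ?_
      have h1 := mul_pow_div_factorial_le_exp (hN (i + 1) (hNle _ hyi))
      have h2 := h1.trans (hexp _ hyi)
      have h3 : ((Finset.Icc (-1) 1 : Finset (Fin d → ℤ)).card : ℝ) *
          (l ^ i / (i + 1).factorial) ≤ κ * (l ^ (i + 1) / (i + 1).factorial) := by
        rw [hκ]
        gcongr
        · linarith
        · exact Nat.le_succ i
      have h4 := mul_le_mul_of_nonneg_left (h3.trans h2) ht.le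
      linarith

/-- Bounds for the intensity of a cube neighbourhood, uniformly in the window. -/
theorem measure_cubeNeighborhood_le {d : ℕ} {W : Set (EuclideanSpace ℝ (Fin d))} (hW1 : volume W = 1)
    {t r L : ℝ} (ht : 0 < t) (hr : 0 < r) (h : t * r ^ d ≤ L ∨ t ≤ L) (q : Fin d → ℤ) :
    (ENNReal.ofReal t • volume.restrict W) (cubeNeighborhood r q) ≤ ENNReal.ofReal
      (1 + ((3 * d) ^ d * volume.real (Metric.ball (0 : EuclideanSpace ℝ (Fin d)) 1) + 1) * L) := by
  set b := (3 * d) ^ d * volume.real (Metric.ball (0 : EuclideanSpace ℝ (Fin d)) 1) with hb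
  have hb0 : 0 ≤ b := by positivity
  rw [Measure.smul_apply, smul_eq_mul]
  rcases h with h | h
  · have hL : 0 ≤ L := le_trans (by positivity) h
    calc ENNReal.ofReal t * volume.restrict W (cubeNeighborhood r q)
        ≤ ENNReal.ofReal t * ENNReal.ofReal (b * r ^ d) := by
          gcongr
          exact (Measure.restrict_apply_le _ _).trans (volume_cubeNeighborhood_le hr q)
      _ = ENNReal.ofReal (b * (t * r ^ d)) := by
          rw [← ENNReal.ofReal_mul ht.le]
          ring_nf
      _ ≤ _ := by
          refine ENNReal.ofReal_le_ofReal ?_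
          nlinarith [mul_le_mul_of_nonneg_left h hb0]
  · have hL : 0 ≤ L := ht.le.trans h
    calc ENNReal.ofReal t * volume.restrict W (cubeNeighborhood r q)
        ≤ ENNReal.ofReal t * 1 := by
          gcongr
          refine (measure_mono (Set.subset_univ _)).trans (le_of_eq ?_)
          rw [Measure.restrict_apply_univ, hW1]
      _ ≤ _ := by
          rw [mul_one]
          refine ENNReal.ofReal_le_ofReal ?_
          nlinarith [mul_nonneg hb0 hL]

theorem mainTheorem9 (d k : ℕ) (hd : 1 ≤ d) (hk : 1 ≤ k) :
    (∀ L : ℝ, ∃ c : ℝ, 0 < c ∧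
      ∀ W : Set (EuclideanSpace ℝ (Fin d)), IsCompact W → Convex ℝ W → volume W = 1 →
      ∀ t r : ℝ, 0 < t → 0 < r → t * r ^ d ≤ L →
      ∀ (Ω : Type*) [MeasurableSpace Ω] (P : Measure Ω) [IsProbabilityMeasure P]
        (η : Ω → Set (EuclideanSpace ℝ (Fin d))),
        IsPoissonProcess P (ENNReal.ofReal t • volume.restrict W) η →
      ∀ m : ℝ, IsMedian P (fun ω => faceCount (η ω) r k) m →
      ∀ u : ℝ, 0 ≤ u → c ≤ u ^ 2 / (u + m) →
        P.real {ω | u ≤ |faceCount (η ω) r k - m|} ≤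
          4 * t * volume.real W *
            Real.exp (-(1 / (4 * ((k : ℝ) + 1) ^ 2) *
              (u ^ (2 / ((k : ℝ) + 1)) / (u + m) ^ (1 / ((k : ℝ) + 1)))))) ∧
    (∀ δ : ℝ → ℝ, (∀ t, 0 < t → 0 < δ t) → Tendsto δ atTop (𝓝 0) →
      (∃ a : ℝ, Tendsto (fun t => t * δ t ^ d) atTop (𝓝 a)) →
      ∃ c : ℝ, 0 < c ∧
      ∀ W : Set (EuclideanSpace ℝ (Fin d)), IsCompact W → Convex ℝ W → volume W = 1 →
      ∀ t : ℝ, 0 < t →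
      ∀ (Ω : Type*) [MeasurableSpace Ω] (P : Measure Ω) [IsProbabilityMeasure P]
        (η : Ω → Set (EuclideanSpace ℝ (Fin d))),
        IsPoissonProcess P (ENNReal.ofReal t • volume.restrict W) η →
      ∀ m : ℝ, IsMedian P (fun ω => faceCount (η ω) (δ t) k) m →
      ∀ u : ℝ, 0 ≤ u → c ≤ u ^ 2 / (u + m) →
        P.real {ω | u ≤ |faceCount (η ω) (δ t) k - m|} ≤
          4 * t * volume.real W *
            Real.exp (-(1 / (4 * ((k : ℝ) + 1) ^ 2) *
              (u ^ (2 / ((k : ℝ) + 1)) / (u + m) ^ (1 / ((k : ℝ) + 1)))))) := by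
  have hl : ∀ L : ℝ, 1 ≤ 1 + ((3 * d) ^ d *
      volume.real (Metric.ball (0 : EuclideanSpace ℝ (Fin d)) 1) + 1) * |L| := fun L => by
    have : 0 ≤ ((3 * d) ^ d *
      volume.real (Metric.ball (0 : EuclideanSpace ℝ (Fin d)) 1) + 1) * |L| := by positivity
    linarith
  refine ⟨fun L => ?_, fun δ hδ _ ⟨a, ha⟩ => ?_⟩
  · obtain ⟨c, hc, h⟩ := exists_faceCount_concentration_constant d hk (hl L)
    refine ⟨c, hc, fun W hW _ hW1 t r ht hr hL => h W hW hW1 t r ht hr fun q => ?_⟩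
    exact measure_cubeNeighborhood_le hW1 ht hr (Or.inl (hL.trans (le_abs_self L))) q
  -- Convergence controls t·δ(t)^d only beyond t₀. Below t₀ the radius may be arbitrary, but the
  -- total mass t ≤ t₀ bounds every block.
  · obtain ⟨t₀, ht₀⟩ := eventually_atTop.1 (ha.eventually_le_const (lt_add_one a))
    set L := max (a + 1) t₀ with hL
    obtain ⟨c, hc, h⟩ := exists_faceCount_concentration_constant d hk (hl L)
    refine ⟨c, hc, fun W hW _ hW1 t ht => h W hW hW1 t (δ t) ht (hδ t ht) fun q => ?_⟩
    refine measure_cubeNeighborhood_le hW1 ht (hδ t ht) ?_ q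
    rcases le_total t₀ t with h' | h'
    · exact Or.inl ((ht₀ t h').trans ((le_max_left _ _).trans (le_abs_self L)))
    · exact Or.inr (h'.trans ((le_max_right _ _).trans (le_abs_self L)))
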